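/- Let $n,k$ be integers with $0\le k<n$, and let $B,S\subseteq\mathbb{R}^n$ with $S$ nonempty. For $x\in\mathbb{R}^n$ and $r>0$, the $k$-skeleton of the axis-parallel cube with centre $x$ and side length $2r$ is the set of all $y\in\mathbb{R}^n$ for which there is a $k$-element set $I\subseteq\{1,\dots,n\}$ such that $y_i\in[x_i-r,x_i+r]$ for $i\in I$ and $y_i\in\{x_i-r,x_i+r\}$ for $i\notin I$. Suppose that for every $x\in S$ there is $r>0$ such that $B$ contains the $k$-skeleton of the axis-parallel cube with centre $x$ and side length $2r$. Then $$\dim_P(B)\ \ge\ k+\frac{(n-k)(2n-1)}{2n^2}\,\dim_P(S),$$ $$\overline{\dim}_B(B)\ \ge\ \max\left\{k,\ \left(1-\frac{n-k}{2n^2}\right)\overline{\dim}_B(S)\right\},$$ $$\underline{\dim}_B(B)\ \ge\ \max\left\{k,\ \left(1-\frac{n-k}{2n^2}\right)\underline{\dim}_B(S)\right\}.$$ Here $\dim_P$ denotes packing dimension, that is, $\dim_P(A)=\sup\{s\ge 0:\mathcal{P}^s(A)=\infty\}$ with $\mathcal{P}^s$ the $s$-dimensional packing measure, and $\overline{\dim}_B$,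 $\underline{\dim}_B$ denote upper and lower box counting dimension, that is, the $\limsup$ and $\liminf$ as $\delta\to 0^+$ of $\log N_\delta(A)/(-\log\delta)$, where $N_\delta(A)$ is the least number of closed balls of radius $\delta$ that cover $A$. For an unbounded set, $N_\delta(A)=\infty$ and both box counting dimensions are $+\infty$. -/

import Mathlib

open Set Filter Topology Metric
open scoped NNReal ENNReal

noncomputable section

/-- The `k`-skeleton of the axis-parallel cube in `ℝⁿ` with centre `x` and side length `2 * r`:
`k` of the coordinates range over the whole side of the cube, and every other coordinate is an
endpoint of its side. -/
def cubeSkeleton {n : ℕ} (k : ℕ) (x : EuclideanSpace ℝ (Fin n)) (r : ℝ) :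
    Set (EuclideanSpace ℝ (Fin n)) :=
  {y | ∃ I : Finset (Fin n), I.card = k ∧
    (∀ i ∈ I, y i ∈ Icc (x i - r) (x i + r)) ∧
    (∀ i ∉ I, y i = x i - r ∨ y i = x i + r)}

/-- The quotient `log N_δ(A) / (-log δ)`, where `N_δ(A)` is the least number of closed balls of
radius `δ` that cover `A`. It is `⊤` when no finite number of balls suffices. -/
def boxQuotient {X : Type*} [PseudoEMetricSpace X] (A : Set X) (δ : ℝ≥0) : EReal :=
  ENNReal.log ((externalCoveringNumber δ A : ℕ∞) : ℝ≥0∞) / ((-Real.log (δ : ℝ) : ℝ) : EReal)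

/-- Upper box counting dimension. -/
def upperBoxDim {X : Type*} [PseudoEMetricSpace X] (A : Set X) : EReal :=
  limsup (boxQuotient A) (𝓝[>] (0 : ℝ≥0))

/-- Lower box counting dimension. -/
def lowerBoxDim {X : Type*} [PseudoEMetricSpace X] (A : Set X) : EReal :=
  liminf (boxQuotient A) (𝓝[>] (0 : ℝ≥0))

/-- `P^s_δ(A)`: the supremum of the sums `∑ (2 r_i)^s` over collections of pairwise disjoint closed
balls with centres in `A` and radii `0 < r_i ≤ δ`. As the terms are nonnegative, finite collections
give the same supremum as arbitrary ones. A ball is recorded as the pair (centre, radius). -/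
def packingSum {X : Type*} [PseudoMetricSpace X] (s : ℝ) (δ : ℝ≥0) (A : Set X) : ℝ≥0∞ :=
  ⨆ (C : Finset (X × ℝ≥0))
    (_ : (∀ p ∈ C, p.1 ∈ A ∧ 0 < p.2 ∧ p.2 ≤ δ) ∧
      (C : Set (X × ℝ≥0)).PairwiseDisjoint (fun p => closedBall p.1 (p.2 : ℝ))),
    ∑ p ∈ C, ((2 * p.2 : ℝ≥0) : ℝ≥0∞) ^ s

/-- The `s`-dimensional packing pre-measure `P^s_0(A) = lim_{δ → 0} P^s_δ(A)`; the limit is an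
infimum because `P^s_δ(A)` is monotone in `δ`. -/
def packingPremeasure {X : Type*} [PseudoMetricSpace X] (s : ℝ) (A : Set X) : ℝ≥0∞ :=
  ⨅ (δ : ℝ≥0) (_ : 0 < δ), packingSum s δ A

/-- The `s`-dimensional packing measure
`P^s(A) = inf {∑ i, P^s_0(A_i) : A ⊆ ⋃ i, A_i}`, over countable covers of `A`. -/
def packingMeasure {X : Type*} [PseudoMetricSpace X] (s : ℝ) (A : Set X) : ℝ≥0∞ :=
  ⨅ (F : ℕ → Set X) (_ : A ⊆ ⋃ i, F i), ∑' i, packingPremeasure s (F i)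

/-- Packing dimension: `sup {s ≥ 0 : P^s(A) = ∞}`. -/
def packingDim {X : Type*} [PseudoMetricSpace X] (A : Set X) : ℝ≥0∞ :=
  ⨆ (s : ℝ≥0) (_ : packingMeasure (s : ℝ) A = ∞), (s : ℝ≥0∞)

end

/-! All bounds rest on one counting inequality in `ℤⁿ`, `card_pow_mul_pow_le`. Let `A` be the set of
centres and `V` the set of vertices of the cubes. Each centre is the midpoint of two vertices along
each of `n` independent diagonals; take these as axes. For each direction, at most `|V| d` centres
lie on a line with at most `d` points of `V`, because a centre is determined by its two vertices.
The remaining centres are controlled by Loomis–Whitney, and balancing `d` gives `|A|^(2n-1) ≲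
|V|^(2n)`. Iterated Loomis–Whitney yields `n - k` coordinates in which `V` has at least
`|V|^((n-k)/n)` projections. Over each of these, `B` has at least `g` points, supplied by the `k`
free coordinates of a face. Hence `|B| ≳ g |A|^((n-k)(2n-1)/(2n²))`.

For box dimensions, round to a grid of mesh `δ / n`. For cubes of half side about `R = 2^j` grid
units with centres in one cell of side `R`, one may take `g = R^k`, while the cell holds only `R^n`
grid points, so `g ≥ |A|^(k/n)` and the exponent of `|A|` rises to `1 - (n-k)/(2n²)`. Adding up the
cells costs bounded overlap. Adding up the scales costs a factor of order `log (1/δ)`, which no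
dimension sees. The bound by `k` comes from a single skeleton.

For packing dimension, let `t > dim_P B`. Then `B` is covered by countably many closed sets with
covering numbers `O(δ^(-t))`. By Baire, every face of every skeleton contains a relatively open
piece lying in one of them. So `S` is a countable union of sets `A m` on which all pieces have size
at least `1/(m+1)` and lie in a finite union of the closed sets. On `A m` the counting inequality
applies with `g` of order `δ^(-k)`, regardless of the sizes of the cubes, and bounds separated sets
polynomially in `1/δ`. -/

/-! ### Projections of lattice sets and the Loomis–Whitney inequality. -/

/-- Coordinate projection: keep the coordinates in `U` and set the others to `0`. -/
def coordProj {ι : Type*} [DecidableEq ι] (U : Finset ι) (x : ι → ℤ) : ι → ℤ :=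
  fun i => if i ∈ U then x i else 0

theorem coordProj_eq_iff {ι : Type*} [DecidableEq ι] {U : Finset ι} {x y : ι → ℤ} :
    coordProj U x = coordProj U y ↔ ∀ i ∈ U, x i = y i := by
  constructor
  · intro h i hi
    simpa [coordProj, hi] using congrFun h i
  · intro h
    funext i
    by_cases hi : i ∈ U
    · simp [coordProj, hi, h i hi]
    · simp [coordProj, hi]

/-- The number of points in the projection of `T` to the coordinates in `U`. -/
def projCard {ι : Type*} [DecidableEq ι] [Fintype ι] (U : Finset ι) (T : Finset (ι → ℤ)) : ℕ :=
  (T.image (coordProj U)).card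

theorem projCard_mono {ι : Type*} [DecidableEq ι] [Fintype ι] (U : Finset ι) {T T' : Finset (ι → ℤ)}
    (h : T ⊆ T') : projCard U T ≤ projCard U T' :=
  Finset.card_le_card (Finset.image_subset_image h)

theorem projCard_pos {ι : Type*} [DecidableEq ι] [Fintype ι] (U : Finset ι) {T : Finset (ι → ℤ)}
    (h : T.Nonempty) : 0 < projCard U T :=
  Finset.card_pos.2 (h.image _)

theorem projCard_univ {ι : Type*} [DecidableEq ι] [Fintype ι] (T : Finset (ι → ℤ)) :
    projCard Finset.univ T = T.card := by
  refine Finset.card_image_of_injective _ fun x y h => ?_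
  funext i
  exact coordProj_eq_iff.1 h i (Finset.mem_univ i)

/-- The coordinate `a` survives the projection, so slicing by its value commutes with projecting.
This is what drives the induction for Loomis–Whitney. -/
theorem projCard_insert {ι : Type*} [DecidableEq ι] [Fintype ι] {U : Finset ι} (a : ι)
    (T : Finset (ι → ℤ)) :
    projCard (insert a U) T =
      ∑ z ∈ T.image (fun x => x a), projCard U (T.filter fun x => x a = z) := by
  unfold projCard
  rw [Finset.card_eq_sum_card_fiberwise (f := fun x : ι → ℤ => x a)
    (t := T.image (fun x => x a))]
  · refine Finset.sum_congr rfl fun z _ => ?_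
    have himg : (T.filter fun x => x a = z).image (coordProj U) =
        ((T.image (coordProj (insert a U))).filter fun x => x a = z).image (coordProj U) := by
      ext w
      simp only [Finset.mem_image, Finset.mem_filter]
      constructor
      · rintro ⟨x, ⟨hx, hz⟩, rfl⟩
        refine ⟨coordProj (insert a U) x, ⟨⟨x, hx, rfl⟩, by simp [coordProj, hz]⟩, ?_⟩
        rw [coordProj_eq_iff]
        intro i hi
        simp [coordProj, hi]
      · rintro ⟨_, ⟨⟨x, hx, rfl⟩, hz⟩, rfl⟩
        refine ⟨x, ⟨hx, by simpa [coordProj] using hz⟩, ?_⟩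
        rw [coordProj_eq_iff]
        intro i hi
        simp [coordProj, hi]
    rw [himg, Finset.card_image_of_injOn]
    intro x hx y hy hxy
    simp only [Finset.coe_filter, Finset.mem_image, Set.mem_ofPred_eq] at hx hy
    obtain ⟨⟨x, -, rfl⟩, hx⟩ := hx
    obtain ⟨⟨y, -, rfl⟩, hy⟩ := hy
    rw [coordProj_eq_iff] at hxy ⊢
    intro i hi
    rcases Finset.mem_insert.1 hi with rfl | hiU
    · simpa [coordProj] using hx.trans hy.symm
    · simpa [coordProj, hiU] using hxy i hiU
  · intro x hx
    simp only [Finset.coe_image, Set.mem_image, Finset.mem_coe] at hx ⊢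
    obtain ⟨x, hx, rfl⟩ := hx
    exact ⟨x, hx, by simp [coordProj]⟩

/-- Hölder's inequality for finitely many functions, in terms of natural numbers. -/
theorem sum_pow_card_le_prod_sum {ι κ : Type*} (U : Finset ι) (hU : U.Nonempty) (Z : Finset κ)
    (g : κ → ℕ) (f : ι → κ → ℕ) (c : ℕ)
    (h : ∀ z ∈ Z, g z ^ U.card ≤ c * ∏ i ∈ U, f i z) :
    (∑ z ∈ Z, g z) ^ U.card ≤ c * ∏ i ∈ U, ∑ z ∈ Z, f i z := by
  have hm : (U.card : ℝ) ≠ 0 := by exact_mod_cast hU.card_pos.ne'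
  have hm0 : 0 ≤ (U.card : ℝ)⁻¹ := by positivity
  let _ : MeasurableSpace κ := ⊤
  -- The sums are integrals against counting measure on `Z`, and Hölder is applied with all weights
  -- equal to `1 / |U|`.
  have hold := ENNReal.lintegral_prod_norm_pow_le (μ := MeasureTheory.Measure.count.restrict (Z : Set κ)) U
    (f := fun i z => (f i z : ℝ≥0∞)) (fun i _ => measurable_from_top.aemeasurable)
    (p := fun _ => (U.card : ℝ)⁻¹) (by simp [hm]) (fun _ _ => hm0)
  have hint : ∀ F : κ → ℝ≥0∞, ∫⁻ z, F z ∂(MeasureTheory.Measure.count.restrict (Z : Set κ))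
      = ∑ z ∈ Z, F z := by
    intro F
    rw [MeasureTheory.lintegral_finset]
    simp
  simp only [hint] at hold
  have key : (∑ z ∈ Z, (g z : ℝ≥0∞)) ≤
      (c : ℝ≥0∞) ^ (U.card : ℝ)⁻¹ * ∏ i ∈ U, (∑ z ∈ Z, (f i z : ℝ≥0∞)) ^ (U.card : ℝ)⁻¹ := by
    refine le_trans ?_ (mul_le_mul_right hold _)
    rw [Finset.mul_sum]
    refine Finset.sum_le_sum fun z hz => ?_
    rw [ENNReal.prod_rpow_of_nonneg hm0, ← ENNReal.mul_rpow_of_nonneg _ _ hm0,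
      ENNReal.le_rpow_inv_iff (by positivity), ENNReal.rpow_natCast]
    exact_mod_cast h z hz
  rw [ENNReal.prod_rpow_of_nonneg hm0, ← ENNReal.mul_rpow_of_nonneg _ _ hm0,
      ENNReal.le_rpow_inv_iff (by positivity), ENNReal.rpow_natCast] at key
  exact_mod_cast key

/-- The Loomis–Whitney inequality. -/
theorem loomis_whitney {ι : Type*} [DecidableEq ι] [Fintype ι] (U : Finset ι) :
    ∀ T : Finset (ι → ℤ), T.Nonempty →
      projCard U T ^ (U.card - 1) ≤ ∏ i ∈ U, projCard (U.erase i) T := by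
  induction U using Finset.induction with
  | empty => intro T _; simp
  | insert a U ha ih =>
    intro T hT
    rw [Finset.prod_insert ha, Finset.erase_insert ha, Finset.card_insert_of_notMem ha,
      Nat.add_sub_cancel]
    rcases U.eq_empty_or_nonempty with rfl | hU
    · simpa [Nat.one_le_iff_ne_zero] using (projCard_pos ∅ hT).ne'
    have herase : ∀ i ∈ U, (insert a U).erase i = insert a (U.erase i) := by
      intro i hi
      rw [Finset.erase_insert_of_ne]
      rintro rfl
      exact ha hi
    rw [Finset.prod_congr rfl fun i hi => by rw [herase i hi, projCard_insert a T],
      projCard_insert a T]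
    -- On each slice one factor is bounded by the projection of all of `T`, which is the term for
    -- `a`, and the other `|U| - 1` factors by the induction hypothesis; Hölder then adds up the
    -- slices.
    refine sum_pow_card_le_prod_sum U hU _ _ _ _ fun z hz => ?_
    have hne : (T.filter fun x => x a = z).Nonempty := by
      obtain ⟨x, hx, rfl⟩ := Finset.mem_image.1 hz
      exact ⟨x, by simp [hx]⟩
    obtain ⟨m, hm⟩ : ∃ m, U.card = m + 1 := ⟨U.card - 1, by have := hU.card_pos; omega⟩
    have := ih _ hne
    rw [hm, Nat.add_sub_cancel] at this
    rw [hm, pow_succ, mul_comm]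
    exact Nat.mul_le_mul (projCard_mono U (Finset.filter_subset _ _)) this

/-- The largest factor in Loomis–Whitney is at least the geometric mean. -/
theorem exists_projCard_erase {ι : Type*} [DecidableEq ι] [Fintype ι] {U : Finset ι} (hU : U.Nonempty)
    {T : Finset (ι → ℤ)} (hT : T.Nonempty) :
    ∃ i ∈ U, projCard U T ^ (U.card - 1) ≤ projCard (U.erase i) T ^ U.card := by
  obtain ⟨i, hi, hmax⟩ := U.exists_max_image (fun i => projCard (U.erase i) T) hU
  refine ⟨i, hi, (loomis_whitney U T hT).trans ?_⟩
  exact Finset.prod_le_pow_card _ _ _ hmax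

/-- Some projection of `T` to `n - k` coordinates has at least `|T| ^ ((n - k) / n)` points. -/
theorem exists_projCard_pow_ge {ι : Type*} [DecidableEq ι] [Fintype ι] {T : Finset (ι → ℤ)}
    (hT : T.Nonempty) (k : ℕ) (hk : k < Fintype.card ι) :
    ∃ U : Finset ι, U.card = Fintype.card ι - k ∧
      T.card ^ (Fintype.card ι - k) ≤ projCard U T ^ Fintype.card ι := by
  induction k with
  | zero => exact ⟨Finset.univ, by simp, by simp [projCard_univ]⟩
  | succ k ih =>
    obtain ⟨U, hU, hle⟩ := ih (by omega)
    have hUne : U.Nonempty := Finset.card_pos.1 (by omega)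
    obtain ⟨i, hi, h⟩ := exists_projCard_erase hUne hT
    refine ⟨U.erase i, by rw [Finset.card_erase_of_mem hi, hU]; omega, ?_⟩
    have hpos : Fintype.card ι - k ≠ 0 := by omega
    -- Raising to the power `n - k` matches the exponent with which the projection onto `U.erase i`
    -- enters `h`.
    rw [← Nat.pow_le_pow_iff_left hpos]
    rw [hU] at h
    have e : Fintype.card ι - (k + 1) = Fintype.card ι - k - 1 := by omega
    rw [e]
    calc (T.card ^ (Fintype.card ι - k - 1)) ^ (Fintype.card ι - k)
        = (T.card ^ (Fintype.card ι - k)) ^ (Fintype.card ι - k - 1) := by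
          rw [← pow_mul, ← pow_mul, mul_comm]
      _ ≤ (projCard U T ^ Fintype.card ι) ^ (Fintype.card ι - k - 1) :=
          Nat.pow_le_pow_left hle _
      _ = (projCard U T ^ (Fintype.card ι - k - 1)) ^ Fintype.card ι := by
          rw [← pow_mul, ← pow_mul, mul_comm]
      _ ≤ (projCard (U.erase i) T ^ (Fintype.card ι - k)) ^ Fintype.card ι :=
          Nat.pow_le_pow_left h _
      _ = (projCard (U.erase i) T ^ Fintype.card ι) ^ (Fintype.card ι - k) := by
          rw [← pow_mul, ← pow_mul, mul_comm]

/-- The fibres of `V` over distinct projected points are disjoint. -/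
theorem projCard_mul_le_card {ι : Type*} [DecidableEq ι] [Fintype ι] (U : Finset ι)
    (T V : Finset (ι → ℤ)) (g : ℕ)
    (h : ∀ a ∈ T, g ≤ (V.filter fun v => coordProj U v = coordProj U a).card) :
    projCard U T * g ≤ V.card := by
  calc projCard U T * g
      ≤ ∑ p ∈ T.image (coordProj U), (V.filter fun v => coordProj U v = p).card := by
        rw [projCard, ← smul_eq_mul]
        refine Finset.card_nsmul_le_sum _ _ _ fun p hp => ?_
        obtain ⟨a, ha, rfl⟩ := Finset.mem_image.1 hp
        exact h a ha
    _ = (V.filter fun v => coordProj U v ∈ T.image (coordProj U)).card := by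
        rw [Finset.card_eq_sum_card_fiberwise (f := coordProj U) (t := T.image (coordProj U))]
        · refine Finset.sum_congr rfl fun p hp => ?_
          rw [Finset.filter_filter]
          congr 1
          ext v
          simp only [Finset.mem_filter]
          constructor
          · rintro ⟨h1, rfl⟩
            exact ⟨h1, hp, rfl⟩
          · rintro ⟨h1, -, h2⟩
            exact ⟨h1, h2⟩
        · intro v hv
          exact (Finset.mem_filter.1 hv).2
    _ ≤ V.card := Finset.card_filter_le _ _

/-! ### Counting cube centres by vertices. -/

/-- If every point of `T` is, in each coordinate direction, the midpoint of two points of `V`,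
then `|T| ≤ C |V| ^ (2n / (2n - 1))`. -/
theorem card_pow_le_of_axis_midpoints {ι : Type*} [DecidableEq ι] [Fintype ι] [Nonempty ι]
    (T V : Finset (ι → ℤ))
    (h : ∀ a ∈ T, ∀ j, ∃ v ∈ V, ∃ w ∈ V, (∀ i ≠ j, v i = a i ∧ w i = a i) ∧
      v j + w j = 2 * a j) :
    T.card ^ (2 * Fintype.card ι - 1) ≤
      (Fintype.card ι + 1) ^ (2 * Fintype.card ι - 1) * V.card ^ (2 * Fintype.card ι) := by
  set n := Fintype.card ι with hn
  have hnpos : 0 < n := Fintype.card_pos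
  rcases T.eq_empty_or_nonempty with rfl | hT
  · rw [Finset.card_empty, zero_pow (by omega)]; exact Nat.zero_le _
  have hm : 0 < V.card := by
    obtain ⟨a, ha⟩ := hT
    obtain ⟨v, hv, -⟩ := h a ha (Classical.arbitrary ι)
    exact Finset.card_pos.2 ⟨v, hv⟩
  obtain ⟨m, hmdef⟩ : ∃ m : ℝ, m = V.card := ⟨_, rfl⟩
  have hmpos : 0 < m := by rw [hmdef]; exact_mod_cast hm
  -- This threshold balances the two cases: `(m / d) ^ n = (m * d) ^ (n - 1)` exactly when `d ^ (2n
  -- - 1) = m`.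
  obtain ⟨d, hd0, hd⟩ : ∃ d : ℝ, 0 < d ∧ d ^ (2 * n - 1) = m := by
    refine ⟨m ^ (((2 * n - 1 : ℕ) : ℝ)⁻¹), by positivity, ?_⟩
    exact Real.rpow_inv_natCast_pow hmpos.le (by omega)
  let π : ι → (ι → ℤ) → (ι → ℤ) := fun j => coordProj (Finset.univ.erase j)
  have hπ : ∀ j x y, π j x = π j y ↔ ∀ i ≠ j, x i = y i := by
    intro j x y
    simp only [π, coordProj_eq_iff]
    simp
  let line : ι → (ι → ℤ) → Finset (ι → ℤ) := fun j a => V.filter fun v => π j v = π j a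
  let poor : ι → Finset (ι → ℤ) := fun j => T.filter fun a => ((line j a).card : ℝ) ≤ d
  let rich : Finset (ι → ℤ) := T.filter fun a => ∀ j, d < ((line j a).card : ℝ)
  -- A poor point is recovered from the pair `(v, w)`: there are at most `m` choices of `v`, and
  -- then at most `d` of `w` on the same line.
  have hpoor : ∀ j, ((poor j).card : ℝ) ≤ m * d := by
    intro j
    choose! v hv w hw hvw hsum using fun a ha => h a ha j
    let P := (V.filter fun x => ((line j x).card : ℝ) ≤ d).sigma fun x => line j x
    have hcard : (poor j).card ≤ P.card := by
      refine Finset.card_le_card_of_injOn (fun a => (⟨v a, w a⟩ : Σ _ : ι → ℤ, ι → ℤ)) ?_ ?_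
      · intro a ha
        obtain ⟨haT, had⟩ := Finset.mem_filter.1 ha
        have e1 : π j (v a) = π j a := (hπ _ _ _).2 fun i hi => (hvw a haT i hi).1
        have e2 : π j (w a) = π j (v a) :=
          (hπ _ _ _).2 fun i hi => (hvw a haT i hi).2.trans (hvw a haT i hi).1.symm
        have e3 : line j (v a) = line j a := by simp only [line, e1]
        simp only [P, Finset.coe_sigma, Set.mem_sigma_iff, Finset.mem_coe, Finset.mem_filter]
        refine ⟨⟨hv a haT, by rw [e3]; exact had⟩, ?_⟩
        exact Finset.mem_filter.2 ⟨hw a haT, e2⟩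
      · intro a ha b hb hab
        have haT := (Finset.mem_filter.1 ha).1
        have hbT := (Finset.mem_filter.1 hb).1
        simp only [Sigma.mk.injEq, heq_eq_eq] at hab
        funext i
        by_cases hi : i = j
        · subst hi
          have h1 := hsum a haT
          have h2 := hsum b hbT
          rw [hab.1, hab.2] at h1
          omega
        · rw [← (hvw a haT i hi).1, ← (hvw b hbT i hi).1, hab.1]
    calc ((poor j).card : ℝ) ≤ P.card := by exact_mod_cast hcard
      _ = ∑ x ∈ V.filter (fun x => ((line j x).card : ℝ) ≤ d), ((line j x).card : ℝ) := by
          rw [Finset.card_sigma]; push_cast; rfl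
      _ ≤ ∑ _x ∈ V.filter (fun x => ((line j x).card : ℝ) ≤ d), d :=
          Finset.sum_le_sum fun x hx => (Finset.mem_filter.1 hx).2
      _ = ((V.filter (fun x => ((line j x).card : ℝ) ≤ d)).card : ℝ) * d := by
          rw [Finset.sum_const, nsmul_eq_mul]
      _ ≤ m * d := by
          refine mul_le_mul_of_nonneg_right ?_ hd0.le
          rw [hmdef]
          exact_mod_cast Finset.card_filter_le _ _
  -- Each line through a rich point has more than `d` points of `V`, so every projection of `rich`
  -- along an axis has fewer than `m / d` points; too many rich points would contradict
  -- Loomis–Whitney.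
  have hrich : (rich.card : ℝ) ≤ m * d := by
    by_contra! hlt
    have hne : rich.Nonempty := by
      rw [← Finset.card_pos]
      have : (0 : ℝ) < rich.card := lt_trans (by positivity) hlt
      exact_mod_cast this
    have hproj : ∀ j, (projCard (Finset.univ.erase j) rich : ℝ) * d < m := by
      intro j
      obtain ⟨a₀, ha₀, hmin⟩ := rich.exists_min_image (fun a => (line j a).card) hne
      have h1 := projCard_mul_le_card (Finset.univ.erase j) rich V (line j a₀).card hmin
      have h2 : d < (line j a₀).card := (Finset.mem_filter.1 ha₀).2 j
      calc (projCard (Finset.univ.erase j) rich : ℝ) * d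
          < projCard (Finset.univ.erase j) rich * (line j a₀).card :=
            mul_lt_mul_of_pos_left h2 (by exact_mod_cast projCard_pos _ hne)
        _ ≤ m := by rw [hmdef]; exact_mod_cast h1
    have hLW : (rich.card : ℝ) ^ (n - 1) ≤ ∏ j, (projCard (Finset.univ.erase j) rich : ℝ) := by
      have := loomis_whitney Finset.univ rich hne
      rw [projCard_univ, Finset.card_univ] at this
      exact_mod_cast this
    have hstrict : (∏ j : ι, (projCard (Finset.univ.erase j) rich : ℝ)) * d ^ n < m ^ n := by
      have : (∏ j : ι, (projCard (Finset.univ.erase j) rich : ℝ) * d) < ∏ _j : ι, m := by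
        refine Finset.prod_lt_prod_of_nonempty (fun j _ => ?_) (fun j _ => hproj j)
          Finset.univ_nonempty
        have : 0 < projCard (Finset.univ.erase j) rich := projCard_pos _ hne
        positivity
      rwa [Finset.prod_mul_distrib, Finset.prod_const, Finset.prod_const, Finset.card_univ] at this
    have h3 : (m * d) ^ (n - 1) * d ^ n ≤ (rich.card : ℝ) ^ (n - 1) * d ^ n := by
      gcongr
    have h4 : (m * d) ^ (n - 1) * d ^ n = m ^ n := by
      obtain ⟨l, hl⟩ : ∃ l, n = l + 1 := ⟨n - 1, by omega⟩
      have h5 : 2 * n - 1 = l + n := by omega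
      rw [h5, pow_add] at hd
      have h6 : n - 1 = l := by omega
      rw [h6, mul_pow, mul_assoc, hd, hl, pow_succ]
    have h7 : (rich.card : ℝ) ^ (n - 1) * d ^ n ≤
        (∏ j : ι, (projCard (Finset.univ.erase j) rich : ℝ)) * d ^ n := by
      gcongr
    linarith
  have hcover : T ⊆ rich ∪ Finset.univ.biUnion poor := by
    intro a ha
    by_cases hr : ∀ j, d < ((line j a).card : ℝ)
    · exact Finset.mem_union_left _ (Finset.mem_filter.2 ⟨ha, hr⟩)
    · push Not at hr
      obtain ⟨j, hj⟩ := hr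
      exact Finset.mem_union_right _
        (Finset.mem_biUnion.2 ⟨j, Finset.mem_univ j, Finset.mem_filter.2 ⟨ha, hj⟩⟩)
  have htotal : (T.card : ℝ) ≤ (n + 1) * (m * d) := by
    have h1 : T.card ≤ rich.card + ∑ j, (poor j).card :=
      (Finset.card_le_card hcover).trans ((Finset.card_union_le _ _).trans
        (Nat.add_le_add_left Finset.card_biUnion_le _))
    calc (T.card : ℝ) ≤ rich.card + ∑ j, ((poor j).card : ℝ) := by exact_mod_cast h1
      _ ≤ m * d + ∑ _j : ι, m * d := add_le_add hrich (Finset.sum_le_sum fun j _ => hpoor j)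
      _ = (n + 1) * (m * d) := by
          rw [Finset.sum_const, Finset.card_univ, nsmul_eq_mul]; ring
  have hfin : (T.card : ℝ) ^ (2 * n - 1) ≤ (n + 1) ^ (2 * n - 1) * m ^ (2 * n) := by
    calc (T.card : ℝ) ^ (2 * n - 1) ≤ ((n + 1) * (m * d)) ^ (2 * n - 1) := by gcongr
      _ = (n + 1) ^ (2 * n - 1) * (m ^ (2 * n - 1) * m) := by rw [mul_pow, mul_pow, hd]
      _ = (n + 1) ^ (2 * n - 1) * m ^ (2 * n) := by
          rw [← pow_succ]; congr 2; omega
  rw [hmdef] at hfin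
  exact_mod_cast hfin

/-- Linear coordinates on `ι → ℤ` for which `n` independent diagonals of the cube become the
coordinate axes. -/
def diagonalCoords {ι : Type*} [DecidableEq ι] [Fintype ι] (o : ι) :
    (ι → ℤ) →ₗ[ℤ] (ι → ℤ) where
  -- The `o`-th entry is chosen to vanish on the diagonals with a single minus sign at `j ≠ o`:
  -- there `x o = 1` and only the `j`-th summand, equal to 2, is nonzero.
  toFun x i := if i = o then 2 * x o - ∑ j, (x o - x j) else x o - x i
  map_add' x y := by
    funext i
    by_cases hi : i = o
    · simp only [hi, if_true, Pi.add_apply, add_sub_add_comm, Finset.sum_add_distrib]; ring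
    · simp only [hi, if_false, Pi.add_apply]; ring
  map_smul' c x := by
    funext i
    by_cases hi : i = o
    · simp only [hi, if_true, Pi.smul_apply, smul_eq_mul, RingHom.id_apply, ← mul_sub,
        ← Finset.mul_sum]
      ring
    · simp only [hi, if_false, Pi.smul_apply, smul_eq_mul, RingHom.id_apply]; ring

theorem diagonalCoords_injective {ι : Type*} [DecidableEq ι] [Fintype ι] (o : ι) :
    Function.Injective (diagonalCoords o) := by
  rw [injective_iff_map_eq_zero]
  intro x hx
  have h1 : ∀ i, x i = x o := by
    intro i
    by_cases hi : i = o
    · rw [hi]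
    · have := congrFun hx i
      simp only [diagonalCoords, LinearMap.coe_mk, AddHom.coe_mk, hi, if_false,
        Pi.zero_apply] at this
      omega
  have h2 := congrFun hx o
  simp only [diagonalCoords, LinearMap.coe_mk, AddHom.coe_mk, if_true, Pi.zero_apply, h1,
    sub_self, Finset.sum_const_zero] at h2
  funext i
  rw [h1 i, Pi.zero_apply]
  omega

/-- The diagonal of the cube which `diagonalCoords o` takes to the `j`-th coordinate axis. -/
def diagonalDir {ι : Type*} [DecidableEq ι] (o j : ι) : ι → ℤ :=
  fun i => if i = j ∧ j ≠ o then -1 else 1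

theorem diagonalDir_eq_or {ι : Type*} [DecidableEq ι] (o j i : ι) :
    diagonalDir o j i = 1 ∨ diagonalDir o j i = -1 := by
  unfold diagonalDir
  split_ifs <;> simp

theorem diagonalCoords_diagonalDir {ι : Type*} [DecidableEq ι] [Fintype ι] {o j i : ι}
    (hij : i ≠ j) : diagonalCoords o (diagonalDir o j) i = 0 := by
  have ho : diagonalDir o j o = 1 := by
    unfold diagonalDir
    rw [if_neg]
    rintro ⟨h1, h2⟩
    exact h2 h1.symm
  simp only [diagonalCoords, LinearMap.coe_mk, AddHom.coe_mk, ho]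
  by_cases hi : i = o
  · subst hi
    have : ∀ l, 1 - diagonalDir i j l = if l = j then 2 else 0 := by
      intro l
      unfold diagonalDir
      by_cases hl : l = j <;> simp [hl, hij.symm]
    simp [this]
  · have : diagonalDir o j i = 1 := by simp [diagonalDir, hij]
    simp [hi, this]

/-- In diagonal coordinates, adding `±ρ a` times the `j`-th diagonal moves `a` only along the `j`-th
axis, by opposite amounts, so opposite vertices are the required axis-parallel pairs. -/
theorem card_pow_le_of_vertices {ι : Type*} [DecidableEq ι] [Fintype ι] [Nonempty ι]
    (A V : Finset (ι → ℤ)) (ρ : (ι → ℤ) → ℤ)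
    (h : ∀ a ∈ A, ∀ σ : ι → ℤ, (∀ i, σ i = 1 ∨ σ i = -1) → a + ρ a • σ ∈ V) :
    A.card ^ (2 * Fintype.card ι - 1) ≤
      (Fintype.card ι + 1) ^ (2 * Fintype.card ι - 1) * V.card ^ (2 * Fintype.card ι) := by
  let o : ι := Classical.arbitrary ι
  let Y := diagonalCoords o
  have hmain := card_pow_le_of_axis_midpoints (A.image Y) (V.image Y) ?_
  · rw [Finset.card_image_of_injective _ (diagonalCoords_injective o),
      Finset.card_image_of_injective _ (diagonalCoords_injective o)] at hmain
    exact hmain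
  · intro y hy j
    obtain ⟨a, ha, rfl⟩ := Finset.mem_image.1 hy
    refine ⟨_, Finset.mem_image_of_mem Y (h a ha _ (diagonalDir_eq_or o j)),
      _, Finset.mem_image_of_mem Y (h a ha (-diagonalDir o j) ?_), ?_, ?_⟩
    · intro i
      rcases diagonalDir_eq_or o j i with h1 | h1 <;> simp [h1]
    · intro i hi
      have := diagonalCoords_diagonalDir (o := o) hi
      simp only [Y, map_add, map_smul, map_neg, Pi.add_apply, Pi.smul_apply, Pi.neg_apply, this]
      simp
    · simp only [map_add, map_smul, map_neg, Pi.add_apply, Pi.smul_apply, Pi.neg_apply, smul_neg]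
      ring

/-! ### Counting points of discrete skeletons. -/

/-- The basic counting inequality: if `B` contains, over the projection of each vertex of each
cube to each set of `n - k` coordinates, at least `g` points, then `B` is large. -/
theorem card_pow_mul_pow_le {ι : Type*} [DecidableEq ι] [Fintype ι] [Nonempty ι] {k : ℕ}
    (hk : k < Fintype.card ι) (A B : Finset (ι → ℤ)) (ρ : (ι → ℤ) → ℤ) (g : ℕ)
    (h : ∀ a ∈ A, ∀ σ : ι → ℤ, (∀ i, σ i = 1 ∨ σ i = -1) → ∀ U : Finset ι,
      U.card = Fintype.card ι - k →
      g ≤ (B.filter fun b => ∀ i ∈ U, b i = a i + ρ a * σ i).card) :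
    A.card ^ ((2 * Fintype.card ι - 1) * (Fintype.card ι - k)) * g ^ (2 * Fintype.card ι ^ 2) ≤
      (Fintype.card ι + 1) ^ ((2 * Fintype.card ι - 1) * (Fintype.card ι - k)) *
        B.card ^ (2 * Fintype.card ι ^ 2) := by
  set n := Fintype.card ι with hn
  have hnpos : 0 < n := Fintype.card_pos
  rcases A.eq_empty_or_nonempty with rfl | hA
  · rw [Finset.card_empty, zero_pow, zero_mul]
    · exact Nat.zero_le _
    · exact (Nat.mul_pos (by omega) (by omega)).ne'
  let signs : Finset (ι → ℤ) := Fintype.piFinset fun _ => {1, -1}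
  have hsigns : ∀ σ, σ ∈ signs ↔ ∀ i, σ i = 1 ∨ σ i = -1 := by
    intro σ; simp [signs]
  let V : Finset (ι → ℤ) := (A ×ˢ signs).image fun p => p.1 + ρ p.1 • p.2
  have hV : ∀ a ∈ A, ∀ σ : ι → ℤ, (∀ i, σ i = 1 ∨ σ i = -1) → a + ρ a • σ ∈ V := by
    intro a ha σ hσ
    exact Finset.mem_image.2 ⟨(a, σ), by simp [ha, (hsigns σ).2 hσ], rfl⟩
  have hVne : V.Nonempty := by
    obtain ⟨a, ha⟩ := hA
    exact ⟨_, hV a ha (fun _ => 1) (by simp)⟩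
  obtain ⟨U, hU, hVU⟩ := exists_projCard_pow_ge hVne k hk
  have hPg : projCard U V * g ≤ B.card := by
    refine projCard_mul_le_card U V B g fun v hv => ?_
    obtain ⟨⟨a, σ⟩, hp, rfl⟩ := Finset.mem_image.1 hv
    rw [Finset.mem_product] at hp
    refine (h a hp.1 σ ((hsigns σ).1 hp.2) U hU).trans (Finset.card_le_card fun b hb => ?_)
    rw [Finset.mem_filter] at hb ⊢
    refine ⟨hb.1, coordProj_eq_iff.2 fun i hi => ?_⟩
    simpa using hb.2 i hi
  have hAV := card_pow_le_of_vertices A V ρ hV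
  rw [← hn] at hAV hVU
  calc A.card ^ ((2 * n - 1) * (n - k)) * g ^ (2 * n ^ 2)
      ≤ ((n + 1) ^ (2 * n - 1) * V.card ^ (2 * n)) ^ (n - k) * g ^ (2 * n ^ 2) := by
        rw [pow_mul]
        exact Nat.mul_le_mul_right _ (Nat.pow_le_pow_left hAV _)
    _ = (n + 1) ^ ((2 * n - 1) * (n - k)) * ((V.card ^ (n - k)) ^ (2 * n) * g ^ (2 * n ^ 2)) := by
        rw [mul_pow, ← pow_mul, ← pow_mul, ← pow_mul, mul_comm (2 * n) (n - k), mul_assoc]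
    _ ≤ (n + 1) ^ ((2 * n - 1) * (n - k)) *
        ((projCard U V ^ n) ^ (2 * n) * g ^ (2 * n ^ 2)) := by
        gcongr
    _ = (n + 1) ^ ((2 * n - 1) * (n - k)) * (projCard U V * g) ^ (2 * n ^ 2) := by
        rw [← pow_mul, mul_pow]
        congr 3
        ring
    _ ≤ _ := by gcongr

/-- The fibre contains a product of sets, with a singleton for each coordinate in `U` and at least
`g` values for each of the other `k`. -/
theorem pow_le_card_filter {ι : Type*} [DecidableEq ι] [Fintype ι] {k : ℕ}
    (hk : k ≤ Fintype.card ι) {U : Finset ι} (hU : U.card = Fintype.card ι - k)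
    (B : Finset (ι → ℤ)) (c : ι → ℤ) (S : ι → Finset ℤ) (g : ℕ) (hS : ∀ i ∉ U, g ≤ (S i).card)
    (hB : ∀ b : ι → ℤ, (∀ i ∈ U, b i = c i) → (∀ i ∉ U, b i ∈ S i) → b ∈ B) :
    g ^ k ≤ (B.filter fun b => ∀ i ∈ U, b i = c i).card := by
  calc g ^ k = ∏ i : ι, if i ∈ U then 1 else g := by
        rw [Finset.prod_ite, Finset.prod_const_one, one_mul, Finset.prod_const]
        congr 1
        rw [Finset.filter_not, Finset.card_sdiff_of_subset (Finset.filter_subset _ _)]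
        simp only [Finset.filter_univ_mem, Finset.card_univ]
        omega
    _ ≤ ∏ i : ι, (if i ∈ U then {c i} else S i).card := by
        refine Finset.prod_le_prod' fun i _ => ?_
        by_cases hi : i ∈ U
        · simp [hi]
        · simpa [hi] using hS i hi
    _ = (Fintype.piFinset fun i => if i ∈ U then {c i} else S i).card := by
        rw [Fintype.card_piFinset]
    _ ≤ _ := by
        refine Finset.card_le_card fun b hb => ?_
        rw [Fintype.mem_piFinset] at hb
        have h1 : ∀ i ∈ U, b i = c i := fun i hi => by simpa [hi] using hb i
        exact Finset.mem_filter.2 ⟨hB b h1 fun i hi => by simpa [hi] using hb i, h1⟩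

theorem pow_le_card_of_forall_mem {ι : Type*} [DecidableEq ι] [Fintype ι] {k : ℕ}
    (hk : k ≤ Fintype.card ι) {U : Finset ι} (hU : U.card = Fintype.card ι - k)
    (B : Finset (ι → ℤ)) (c : ι → ℤ) (S : ι → Finset ℤ) (g : ℕ) (hS : ∀ i ∉ U, g ≤ (S i).card)
    (hB : ∀ b : ι → ℤ, (∀ i ∈ U, b i = c i) → (∀ i ∉ U, b i ∈ S i) → b ∈ B) :
    g ^ k ≤ B.card :=
  (pow_le_card_filter hk hU B c S g hS hB).trans (Finset.card_filter_le _ _)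

/-- The enlarged cells overlap at most `7 ^ n` times: each `q i` must be one of the seven integers
within 3 of `⌊b i / R⌋`. -/
theorem sum_card_cells_le {ι : Type*} [DecidableEq ι] [Fintype ι] {R : ℤ} (hR : 0 < R)
    (B Q : Finset (ι → ℤ)) :
    ∑ q ∈ Q, (B.filter fun b => ∀ i, |b i - R * q i| ≤ 3 * R).card ≤
      7 ^ Fintype.card ι * B.card := by
  have := Finset.sum_card_bipartiteAbove_eq_sum_card_bipartiteBelow (s := Q) (t := B)
    (fun (q b : ι → ℤ) => ∀ i, |b i - R * q i| ≤ 3 * R)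
  simp only [Finset.bipartiteAbove, Finset.bipartiteBelow] at this
  rw [this, mul_comm (7 ^ Fintype.card ι), ← smul_eq_mul]
  refine Finset.sum_le_card_nsmul B _ (7 ^ Fintype.card ι) fun b _ => ?_
  calc (Q.filter fun q => ∀ i, |b i - R * q i| ≤ 3 * R).card
      ≤ (Fintype.piFinset fun i => Finset.Icc (b i / R - 3) (b i / R + 3)).card := by
        refine Finset.card_le_card fun q hq => ?_
        rw [Fintype.mem_piFinset]
        intro i
        have h1 := abs_le.1 ((Finset.mem_filter.1 hq).2 i)
        rw [Finset.mem_Icc]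
        constructor
        · have : b i / R ≤ q i + 3 := by
            have : b i / R * R ≤ (q i + 3) * R := by
              have := Int.ediv_mul_le (b i) hR.ne'
              linarith
            exact le_of_mul_le_mul_right this hR
          linarith
        · have : q i - 3 ≤ b i / R := by
            rw [Int.le_ediv_iff_mul_le hR]
            linarith
          linarith
    _ = 7 ^ Fintype.card ι := by
        rw [Fintype.card_piFinset, Finset.prod_congr rfl fun i _ => ?_, Finset.prod_const,
          Finset.card_univ]
        rw [Int.card_Icc]
        omega

/-- The bound for cubes whose half side lengths are comparable to `2 ^ j` and whose centres lie in
one cell of side length `2 ^ j`. -/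
theorem card_cell_pow_le {ι : Type*} [DecidableEq ι] [Fintype ι] [Nonempty ι] {k : ℕ}
    (hk : k < Fintype.card ι) (A B : Finset (ι → ℤ)) (ρ : (ι → ℤ) → ℕ) (j : ℕ) (q : ι → ℤ)
    (hj : ∀ a ∈ A, Nat.log 2 (ρ a) = j) (hq : ∀ a ∈ A, ∀ i, a i / 2 ^ j = q i)
    (h : ∀ a ∈ A, ∀ U : Finset ι, U.card = Fintype.card ι - k → ∀ b : ι → ℤ,
      (∀ i ∈ U, b i = a i - ρ a ∨ b i = a i + ρ a) → (∀ i ∉ U, |b i - a i| ≤ ρ a) → b ∈ B) :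
    A.card ^ (2 * Fintype.card ι ^ 2 - (Fintype.card ι - k)) ≤
      (Fintype.card ι + 1) ^ ((2 * Fintype.card ι - 1) * (Fintype.card ι - k)) *
        (B.filter fun b => ∀ i, |b i - 2 ^ j * q i| ≤ 3 * 2 ^ j).card ^
          (2 * Fintype.card ι ^ 2) := by
  set n := Fintype.card ι with hn
  have hcount := card_pow_mul_pow_le hk A
    (B.filter fun b => ∀ i, |b i - 2 ^ j * q i| ≤ 3 * 2 ^ j) (fun a => ρ a) ((2 ^ j) ^ k) ?_
  · rw [← hn] at hcount
    refine le_trans ?_ hcount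
    -- A cell of side `2 ^ j` has `(2 ^ j) ^ n` lattice points. So `|A| ^ (2nk)` is at most the
    -- power of `g = (2 ^ j) ^ k` in `hcount`, which raises the exponent of `|A|`.
    have hA : A.card ≤ (2 ^ j) ^ n := by
      calc A.card ≤ (Fintype.piFinset fun i =>
            Finset.Ico (2 ^ j * q i) (2 ^ j * q i + 2 ^ j)).card := by
            refine Finset.card_le_card fun a ha => ?_
            rw [Fintype.mem_piFinset]
            intro i
            rw [← hq a ha i, Finset.mem_Ico]
            have h1 := Int.mul_ediv_add_emod (a i) (2 ^ j)
            have h2 := Int.emod_nonneg (a i) (b := 2 ^ j) (by positivity)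
            have h3 := Int.emod_lt_of_pos (a i) (b := 2 ^ j) (by positivity)
            constructor <;> linarith
        _ = (2 ^ j) ^ n := by
            rw [Fintype.card_piFinset, Finset.prod_congr rfl fun i _ => ?_, Finset.prod_const,
              Finset.card_univ]
            rw [Int.card_Ico, add_sub_cancel_left]
            exact_mod_cast Int.toNat_natCast (2 ^ j)
    have hexp : 2 * n ^ 2 - (n - k) = (2 * n - 1) * (n - k) + 2 * n * k := by
      obtain ⟨l, hl⟩ : ∃ l, n = k + l + 1 := ⟨n - k - 1, by omega⟩
      have e1 : n - k = l + 1 := by omega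
      have e2 : 2 * n - 1 = 2 * k + 2 * l + 1 := by omega
      rw [e1, e2, hl]
      refine Nat.sub_eq_of_eq_add ?_
      ring
    calc A.card ^ (2 * n ^ 2 - (n - k))
        = A.card ^ ((2 * n - 1) * (n - k)) * A.card ^ (2 * n * k) := by rw [hexp, pow_add]
      _ ≤ A.card ^ ((2 * n - 1) * (n - k)) * ((2 ^ j) ^ n) ^ (2 * n * k) := by gcongr
      _ = _ := by
        generalize 2 ^ j = R
        rw [← pow_mul, ← pow_mul]
        congr 2
        ring
  · intro a ha σ hσ U hU
    have hlog := hj a ha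
    have h1 : ρ a < 2 * 2 ^ j := by
      rw [← hlog, ← pow_succ']
      exact Nat.lt_pow_succ_log_self (by norm_num) _
    -- A side contains `2 * ρ a + 1` lattice points. Since `Nat.log 2 0 = 0`, half side 0 belongs to
    -- scale `j = 0`, where one point suffices.
    have h2 : 2 ^ j ≤ 2 * ρ a + 1 := by
      rcases Nat.eq_zero_or_pos (ρ a) with h0 | h0
      · rw [h0, Nat.log_zero_right] at hlog
        rw [← hlog, h0]
        norm_num
      · rw [← hlog]
        have := Nat.pow_log_le_self 2 h0.ne'
        omega
    have h1' : (ρ a : ℤ) < 2 * 2 ^ j := by exact_mod_cast h1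
    refine pow_le_card_filter hk.le hU _ (fun i => a i + ρ a * σ i)
      (fun i => Finset.Icc (a i - ρ a) (a i + ρ a)) _ (fun i _ => ?_) fun b hbU hb => ?_
    · rw [Int.card_Icc]
      omega
    · have hbU' : ∀ i ∈ U, b i = a i - ρ a ∨ b i = a i + ρ a := by
        intro i hi
        rw [hbU i hi]
        rcases hσ i with hs | hs
        · right; rw [hs, mul_one]
        · left; rw [hs]; ring
      have hb' : ∀ i ∉ U, |b i - a i| ≤ ρ a := by
        intro i hi
        have := Finset.mem_Icc.1 (hb i hi)
        rw [abs_le]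
        constructor <;> linarith
      -- The window `3 * 2 ^ j` allows `2 ^ j` for the position of the centre in its cell and `2 * 2
      -- ^ j` for the half side.
      refine Finset.mem_filter.2 ⟨h a ha U hU b hbU' hb', fun i => ?_⟩
      have hba : |b i - a i| ≤ ρ a := by
        by_cases hi : i ∈ U
        · rcases hbU' i hi with h3 | h3 <;> simp [h3]
        · exact hb' i hi
      have h3 := abs_le.1 hba
      have h4 := Int.mul_ediv_add_emod (a i) (2 ^ j)
      have h5 := Int.emod_nonneg (a i) (b := 2 ^ j) (by positivity)
      have h6 := Int.emod_lt_of_pos (a i) (b := 2 ^ j) (by positivity)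
      rw [hq a ha i] at h4
      rw [abs_le]
      constructor <;> linarith

/-- If `B` contains the discrete `k`-skeleton of a cube about each point of `A`, and the half side
lengths of the cubes are less than `2 ^ J`, then `|A| ^ (2n² - (n - k)) ≤ C J ^ _ |B| ^ (2n²)`. -/
theorem card_pow_le_of_discrete_skeletons {ι : Type*} [DecidableEq ι] [Fintype ι] [Nonempty ι]
    {k : ℕ} (hk : k < Fintype.card ι) :
    ∃ C : ℕ, ∀ (A B : Finset (ι → ℤ)) (ρ : (ι → ℤ) → ℕ) (J : ℕ),
      (∀ a ∈ A, Nat.log 2 (ρ a) < J) →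
      (∀ a ∈ A, ∀ U : Finset ι, U.card = Fintype.card ι - k → ∀ b : ι → ℤ,
        (∀ i ∈ U, b i = a i - ρ a ∨ b i = a i + ρ a) → (∀ i ∉ U, |b i - a i| ≤ ρ a) → b ∈ B) →
      A.card ^ (2 * Fintype.card ι ^ 2 - (Fintype.card ι - k)) ≤
        (C * J) ^ (2 * Fintype.card ι ^ 2 - (Fintype.card ι - k)) *
          B.card ^ (2 * Fintype.card ι ^ 2) := by
  set n := Fintype.card ι with hn
  set D := 2 * n ^ 2 with hD
  have hlt : n - k < D := by
    have : 0 < n := Fintype.card_pos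
    have : n ≤ n ^ 2 := Nat.le_self_pow (by norm_num) n
    omega
  obtain ⟨P, hP, hPpos, hPD⟩ : ∃ P, D - (n - k) = P ∧ 0 < P ∧ P ≤ D :=
    ⟨_, rfl, by omega, by omega⟩
  rw [hP]
  set K := (n + 1) ^ ((2 * n - 1) * (n - k)) with hK
  have hK1 : 1 ≤ K := Nat.one_le_pow _ _ (by omega)
  refine ⟨K * 7 ^ n, fun A B ρ J hJ h => ?_⟩
  obtain ⟨m, hm⟩ : ∃ m : ℝ, m = B.card := ⟨_, rfl⟩
  have hm0 : 0 ≤ m := by rw [hm]; positivity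
  -- `θ = |B| ^ (D / P - 1)`. It replaces the power `D / P` of the local count by a bound linear in
  -- that count, which can be summed over cells.
  obtain ⟨θ, hθ0, hθ⟩ : ∃ θ : ℝ, 0 ≤ θ ∧ θ ^ P = m ^ (D - P) :=
    ⟨(m ^ (D - P)) ^ ((P : ℝ)⁻¹), by positivity, Real.rpow_inv_natCast_pow (by positivity) hPpos.ne'⟩
  have hcell : ∀ j (q : ι → ℤ),
      ((A.filter fun a => Nat.log 2 (ρ a) = j ∧ (fun i => a i / 2 ^ j) = q).card : ℝ) ≤
        K * θ * (B.filter fun b => ∀ i, |b i - 2 ^ j * q i| ≤ 3 * 2 ^ j).card := by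
    intro j q
    have h0 := card_cell_pow_le hk
      (A.filter fun a => Nat.log 2 (ρ a) = j ∧ (fun i => a i / 2 ^ j) = q) B ρ j q
      (fun a ha => (Finset.mem_filter.1 ha).2.1)
      (fun a ha i => congrFun (Finset.mem_filter.1 ha).2.2 i)
      (fun a ha => h a (Finset.mem_filter.1 ha).1)
    rw [← hn, ← hD, ← hK, hP] at h0
    set x := (A.filter fun a => Nat.log 2 (ρ a) = j ∧ (fun i => a i / 2 ^ j) = q).card
    set y := (B.filter fun b => ∀ i, |b i - 2 ^ j * q i| ≤ 3 * 2 ^ j).card with hy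
    have hym : (y : ℝ) ≤ m := by rw [hm]; exact_mod_cast Finset.card_filter_le _ _
    have h1 : (x : ℝ) ^ P ≤ (K : ℝ) * (y : ℝ) ^ D := by exact_mod_cast h0
    refine (pow_le_pow_iff_left₀ (by positivity) (by positivity) hPpos.ne').1 (h1.trans ?_)
    calc (K : ℝ) * (y : ℝ) ^ D = K * ((y : ℝ) ^ (D - P) * (y : ℝ) ^ P) := by
          rw [← pow_add, Nat.sub_add_cancel hPD]
      _ ≤ (K : ℝ) ^ P * (m ^ (D - P) * (y : ℝ) ^ P) := by
          gcongr
          exact le_self_pow₀ (by exact_mod_cast hK1) hPpos.ne'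
      _ = _ := by rw [← hθ]; ring
  have hscale : ∀ j, ((A.filter fun a => Nat.log 2 (ρ a) = j).card : ℝ) ≤
      K * θ * (7 ^ n * m) := by
    intro j
    let cell : (ι → ℤ) → (ι → ℤ) := fun a i => a i / 2 ^ j
    have h1 : (A.filter fun a => Nat.log 2 (ρ a) = j).card = ∑ q ∈ A.image cell,
        (A.filter fun a => Nat.log 2 (ρ a) = j ∧ cell a = q).card := by
      rw [Finset.card_eq_sum_card_fiberwise (f := cell) (t := A.image cell)]
      · simp only [Finset.filter_filter]
      · intro a ha
        exact Finset.mem_image_of_mem _ (Finset.mem_filter.1 ha).1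
    rw [h1, Nat.cast_sum]
    calc ∑ q ∈ A.image cell, ((A.filter fun a => Nat.log 2 (ρ a) = j ∧ cell a = q).card : ℝ)
        ≤ ∑ q ∈ A.image cell,
          K * θ * ((B.filter fun b => ∀ i, |b i - 2 ^ j * q i| ≤ 3 * 2 ^ j).card : ℝ) :=
          Finset.sum_le_sum fun q _ => hcell j q
      _ = K * θ * ((∑ q ∈ A.image cell,
          (B.filter fun b => ∀ i, |b i - 2 ^ j * q i| ≤ 3 * 2 ^ j).card : ℕ) : ℝ) := by
          rw [← Finset.mul_sum, Nat.cast_sum]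
      _ ≤ K * θ * (7 ^ n * m) := by
          refine mul_le_mul_of_nonneg_left ?_ (by positivity)
          rw [hm]
          exact_mod_cast sum_card_cells_le (R := 2 ^ j) (by positivity) B _
  have htot : (A.card : ℝ) ≤ J * (K * θ * (7 ^ n * m)) := by
    rw [Finset.card_eq_sum_card_fiberwise (f := fun a => Nat.log 2 (ρ a)) (t := Finset.range J)
      (fun a ha => Finset.mem_coe.2 (Finset.mem_range.2 (hJ a ha))), Nat.cast_sum]
    refine (Finset.sum_le_card_nsmul _ _ _ fun j _ => hscale j).trans ?_
    rw [Finset.card_range, nsmul_eq_mul]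
  have hfin : (A.card : ℝ) ^ P ≤ ((K * 7 ^ n : ℕ) * J : ℝ) ^ P * m ^ D := by
    calc (A.card : ℝ) ^ P ≤ (J * (K * θ * (7 ^ n * m))) ^ P := by gcongr
      _ = ((K * 7 ^ n : ℕ) * J : ℝ) ^ P * (θ ^ P * m ^ P) := by push_cast; ring
      _ = _ := by rw [hθ, ← pow_add, Nat.sub_add_cancel hPD]
  rw [hm] at hfin
  exact_mod_cast hfin

/-! ### Discretisation on a grid of mesh `δ / n`. -/

theorem abs_sub_apply_le_dist {n : ℕ} (x y : EuclideanSpace ℝ (Fin n)) (i : Fin n) :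
    |x i - y i| ≤ dist x y := by
  rw [dist_eq_norm]
  exact PiLp.norm_apply_le (x - y) i

theorem dist_le_of_forall_abs_sub_le {n : ℕ} {x y : EuclideanSpace ℝ (Fin n)} {c : ℝ} (hc : 0 ≤ c)
    (h : ∀ i, |x i - y i| ≤ c) : dist x y ≤ n * c := by
  rw [EuclideanSpace.dist_eq]
  refine Real.sqrt_le_iff.2 ⟨by positivity, ?_⟩
  calc ∑ i, dist (x i) (y i) ^ 2 ≤ ∑ _i : Fin n, c ^ 2 :=
        Finset.sum_le_sum fun i _ => pow_le_pow_left₀ dist_nonneg (h i) 2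
    _ = n * c ^ 2 := by simp
    _ ≤ (n * c) ^ 2 := by
        rw [mul_pow]
        gcongr
        exact_mod_cast Nat.le_self_pow (by norm_num) n

/-- The points of the grid `η ℤⁿ` within sup-distance `2 η` of `F`. -/
def gridNear {n : ℕ} (η : ℝ) (F : Set (EuclideanSpace ℝ (Fin n))) : Set (Fin n → ℤ) :=
  {b | ∃ y ∈ F, ∀ i, |y i - η * b i| ≤ 2 * η}

/-- The grid point obtained from `x` by rounding down. -/
noncomputable def gridFloor {n : ℕ} (η : ℝ) (x : EuclideanSpace ℝ (Fin n)) : Fin n → ℤ :=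
  fun i => ⌊x i / η⌋

theorem mul_gridFloor_le {n : ℕ} {η : ℝ} (hη : 0 < η) (x : EuclideanSpace ℝ (Fin n)) (i : Fin n) :
    η * gridFloor η x i ≤ x i := by
  rw [mul_comm, ← le_div_iff₀ hη]
  exact Int.floor_le _

theorem lt_mul_gridFloor_add {n : ℕ} {η : ℝ} (hη : 0 < η) (x : EuclideanSpace ℝ (Fin n))
    (i : Fin n) : x i < η * gridFloor η x i + η := by
  have h : x i / η < gridFloor η x i + 1 := Int.lt_floor_add_one _
  rw [div_lt_iff₀ hη] at h
  linarith

theorem exists_isCover_of_externalCoveringNumber_le {X : Type*} [PseudoEMetricSpace X] {δ : ℝ≥0}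
    {F : Set X} {N : ℕ} (h : externalCoveringNumber δ F ≤ N) :
    ∃ C : Finset X, IsCover δ F (C : Set X) ∧ C.card ≤ N := by
  have h1 : externalCoveringNumber δ F < ((N + 1 : ℕ) : ℕ∞) :=
    h.trans_lt (by exact_mod_cast Nat.lt_succ_self N)
  simp only [externalCoveringNumber, iInf_lt_iff] at h1
  obtain ⟨C, hC, hcard⟩ := h1
  have hfin : C.Finite := Set.finite_of_encard_le_coe hcard.le
  refine ⟨hfin.toFinset, by simpa using hC, ?_⟩
  rw [hfin.encard_eq_coe_toFinset_card] at hcard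
  have : hfin.toFinset.card < N + 1 := by exact_mod_cast hcard
  omega

/-- With `η = δ / n`, a ball of radius `δ` has half width `n η` in each coordinate. Widened by the
tolerance `2 η`, this leaves at most `2n + 5` grid values. -/
theorem card_le_of_subset_gridNear {n : ℕ} (hn : 0 < n) {δ : ℝ≥0} (hδ : 0 < δ)
    {F : Set (EuclideanSpace ℝ (Fin n))} {N : ℕ} (hN : externalCoveringNumber δ F ≤ N)
    {B : Finset (Fin n → ℤ)} (hB : (B : Set (Fin n → ℤ)) ⊆ gridNear (δ / n) F) :
    B.card ≤ (2 * n + 5) ^ n * N := by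
  obtain ⟨C, hC, hCN⟩ := exists_isCover_of_externalCoveringNumber_le hN
  have hn' : (0 : ℝ) < n := by exact_mod_cast hn
  have hδ' : (0 : ℝ) < δ := by exact_mod_cast hδ
  set η : ℝ := δ / n with hη
  have hηpos : 0 < η := by positivity
  let cell : EuclideanSpace ℝ (Fin n) → Finset (Fin n → ℤ) := fun c =>
    Fintype.piFinset fun i => Finset.Icc (⌈c i / η⌉ - (n + 2)) (⌊c i / η⌋ + (n + 2))
  have hcell : ∀ c, (cell c).card ≤ (2 * n + 5) ^ n := by
    intro c
    rw [Fintype.card_piFinset]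
    refine (Finset.prod_le_pow_card _ _ (2 * n + 5) fun i _ => ?_).trans_eq (by simp)
    rw [Int.card_Icc]
    have := Int.floor_le_ceil (c i / η)
    omega
  have hsub : B ⊆ C.biUnion cell := by
    intro b hb
    obtain ⟨y, hy, hyb⟩ := hB hb
    obtain ⟨c, hc, hyc⟩ := hC hy
    have hyc' : dist y c ≤ δ := by
      rw [← coe_nndist]
      have : edist y c ≤ δ := hyc
      rw [edist_nndist] at this
      exact_mod_cast this
    refine Finset.mem_biUnion.2 ⟨c, hc, Fintype.mem_piFinset.2 fun i => ?_⟩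
    have h1 := abs_le.1 (hyb i)
    have h2 := abs_le.1 ((abs_sub_apply_le_dist y c i).trans hyc')
    have h3 : (δ : ℝ) = n * η := by rw [hη]; field_simp
    rw [h3] at h2
    rw [Finset.mem_Icc]
    constructor
    · rw [sub_le_iff_le_add, Int.ceil_le, div_le_iff₀ hηpos]
      push_cast
      linarith
    · rw [← sub_le_iff_le_add, Int.le_floor, le_div_iff₀ hηpos]
      push_cast
      linarith
  calc B.card ≤ ∑ c ∈ C, (cell c).card := (Finset.card_le_card hsub).trans Finset.card_biUnion_le
    _ ≤ C.card * (2 * n + 5) ^ n := Finset.sum_le_card_nsmul _ _ _ fun c _ => hcell c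
    _ ≤ (2 * n + 5) ^ n * N := by rw [mul_comm]; gcongr

theorem gridNear_finite {n : ℕ} (hn : 0 < n) {δ : ℝ≥0} (hδ : 0 < δ)
    {F : Set (EuclideanSpace ℝ (Fin n))} {N : ℕ} (hN : externalCoveringNumber δ F ≤ N) :
    (gridNear (δ / n) F).Finite := by
  by_contra hinf
  obtain ⟨B, hB, hcard⟩ :=
    Set.Infinite.exists_subset_card_eq hinf ((2 * n + 5) ^ n * N + 1)
  have := card_le_of_subset_gridNear hn hδ hN hB
  omega

/-- Euclidean distance is at most `n` times sup-distance, so a grid cell lies in the ball of radius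
`δ` about its lower corner; this is why the mesh is `δ / n`. -/
theorem externalCoveringNumber_le_card_of_gridFloor_mem {n : ℕ} (hn : 0 < n) {δ : ℝ≥0}
    (hδ : 0 < δ) {S : Set (EuclideanSpace ℝ (Fin n))} {A : Finset (Fin n → ℤ)}
    (hA : ∀ x ∈ S, gridFloor (δ / n) x ∈ A) : externalCoveringNumber δ S ≤ A.card := by
  have hn' : (0 : ℝ) < n := by exact_mod_cast hn
  have hδ' : (0 : ℝ) < δ := by exact_mod_cast hδ
  have hη : (0 : ℝ) < δ / n := by positivity
  let p : (Fin n → ℤ) → EuclideanSpace ℝ (Fin n) := fun a => WithLp.toLp 2 fun i => δ / n * a i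
  have hcov : IsCover δ S ((A.image p : Finset _) : Set (EuclideanSpace ℝ (Fin n))) := by
    intro x hx
    refine ⟨p (gridFloor (δ / n) x), ?_, ?_⟩
    · exact Finset.mem_coe.2 (Finset.mem_image_of_mem p (hA x hx))
    · have hd : dist x (p (gridFloor (δ / n) x)) ≤ n * (δ / n) := by
        refine dist_le_of_forall_abs_sub_le hη.le fun i => ?_
        have h1 := mul_gridFloor_le hη x i
        have h2 := lt_mul_gridFloor_add hη x i
        rw [abs_le]
        simp only [p]
        constructor <;> linarith
      rw [mul_div_cancel₀ _ hn'.ne', ← coe_nndist] at hd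
      change edist _ _ ≤ _
      rw [edist_nndist]
      exact_mod_cast hd
  refine hcov.externalCoveringNumber_le_encard.trans ?_
  rw [Set.encard_coe_eq_coe_finsetCard]
  exact_mod_cast Finset.card_image_le

/-- Rounding the centre and rounding the half side each cost at most `η` per coordinate; hence the
tolerance `2 η` in `gridNear`. Free coordinates are clamped into the side of the true cube. -/
theorem mem_gridNear_of_cubeSkeleton_subset {n k : ℕ} (hk : k ≤ n) {η r : ℝ} (hη : 0 < η)
    (hr : 0 < r) {x : EuclideanSpace ℝ (Fin n)} {F : Set (EuclideanSpace ℝ (Fin n))}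
    (hF : cubeSkeleton k x r ⊆ F) {U : Finset (Fin n)} (hU : U.card = n - k) {b : Fin n → ℤ}
    (hbU : ∀ i ∈ U, b i = gridFloor η x i - ⌊r / η⌋₊ ∨ b i = gridFloor η x i + ⌊r / η⌋₊)
    (hb : ∀ i ∉ U, |b i - gridFloor η x i| ≤ ⌊r / η⌋₊) : b ∈ gridNear η F := by
  have hρ1 : η * (⌊r / η⌋₊ : ℝ) ≤ r := by
    rw [mul_comm, ← le_div_iff₀ hη]
    exact Nat.floor_le (by positivity)
  have hρ2 : r < η * (⌊r / η⌋₊ : ℝ) + η := by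
    have h := Nat.lt_floor_add_one (r / η)
    rw [div_lt_iff₀ hη] at h
    linarith
  set ρ := ⌊r / η⌋₊
  let y : EuclideanSpace ℝ (Fin n) := WithLp.toLp 2 fun i =>
    if i ∈ U then (if b i = gridFloor η x i - ρ then x i - r else x i + r)
    else max (x i - r) (min (x i + r) (η * b i))
  refine ⟨y, hF ⟨Uᶜ, ?_, ?_, ?_⟩, ?_⟩
  · rw [Finset.card_compl, Fintype.card_fin, hU]
    omega
  · intro i hi
    rw [Finset.mem_compl] at hi
    simp only [y, hi, if_false]
    exact ⟨le_max_left _ _, max_le (by linarith) (min_le_left _ _)⟩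
  · intro i hi
    rw [Finset.mem_compl, not_not] at hi
    simp only [y, hi, if_true]
    split_ifs <;> simp
  · intro i
    have h1 := mul_gridFloor_le hη x i
    have h2 := lt_mul_gridFloor_add hη x i
    by_cases hi : i ∈ U
    · simp only [y, hi, if_true]
      split_ifs with h
      · rw [h, abs_le]
        push_cast
        constructor <;> linarith
      · rw [(hbU i hi).resolve_left h, abs_le]
        push_cast
        constructor <;> linarith
    · simp only [y, hi, if_false]
      have h3 := abs_le.1 (hb i hi)
      have h4 : (-(ρ : ℝ)) ≤ b i - gridFloor η x i := by exact_mod_cast h3.1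
      have h5 : (b i : ℝ) - gridFloor η x i ≤ ρ := by exact_mod_cast h3.2
      have h6 : η * (b i : ℝ) ≤ η * gridFloor η x i + η * ρ := by
        rw [← mul_add]
        exact mul_le_mul_of_nonneg_left (by linarith) hη.le
      have h7 : η * gridFloor η x i - η * ρ ≤ η * (b i : ℝ) := by
        rw [← mul_sub]
        exact mul_le_mul_of_nonneg_left (by linarith) hη.le
      -- Both roundings go down, so `η * b i ≤ x i + r` and only the lower clamp can act.
      rw [min_eq_right (by linarith)]
      rcases max_cases (x i - r) (η * (b i : ℝ)) with ⟨h, h'⟩ | ⟨h, h'⟩ <;> rw [h, abs_le] <;>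
        constructor <;> linarith

/-- The lower bound for the covering numbers of a set that contains the `k`-skeleton of a cube. -/
theorem pow_le_of_cubeSkeleton_subset {n k : ℕ} (hk : k < n) {δ : ℝ≥0} (hδ : 0 < δ) {r : ℝ}
    (hr : 0 < r) {x : EuclideanSpace ℝ (Fin n)} {F : Set (EuclideanSpace ℝ (Fin n))}
    (hF : cubeSkeleton k x r ⊆ F) {N : ℕ} (hN : externalCoveringNumber δ F ≤ N) :
    (r / δ) ^ k ≤ (2 * n + 5) ^ n * N := by
  have hn : 0 < n := by omega
  have hn' : (1 : ℝ) ≤ n := by exact_mod_cast hn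
  have hδ' : (0 : ℝ) < δ := by exact_mod_cast hδ
  have hη : (0 : ℝ) < δ / n := by positivity
  have hfin := gridNear_finite hn hδ hN
  obtain ⟨U, -, hU⟩ := Finset.exists_subset_card_eq (s := (Finset.univ : Finset (Fin n)))
    (n := n - k) (by simp)
  set ρ := ⌊r / (δ / n)⌋₊ with hρ
  have h1 : (2 * ρ + 1) ^ k ≤ hfin.toFinset.card := by
    refine pow_le_card_of_forall_mem (ι := Fin n) (by simpa using hk.le) (by simpa using hU)
      hfin.toFinset (fun i => gridFloor (δ / n) x i + ρ)
      (fun i => Finset.Icc (gridFloor (δ / n) x i - ρ) (gridFloor (δ / n) x i + ρ)) _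
      (fun i _ => ?_) fun b hbU hb => ?_
    · rw [Int.card_Icc]
      omega
    · rw [Set.Finite.mem_toFinset]
      refine mem_gridNear_of_cubeSkeleton_subset hk.le hη hr hF hU
        (fun i hi => Or.inr (hbU i hi)) fun i hi => ?_
      have := Finset.mem_Icc.1 (hb i hi)
      rw [abs_le]
      constructor <;> linarith
  have h2 := card_le_of_subset_gridNear hn hδ hN (B := hfin.toFinset) (by simp)
  have h3 : r / δ ≤ 2 * ρ + 1 := by
    have h4 : r / (δ / n) < ρ + 1 := Nat.lt_floor_add_one _
    have h5 : r / δ ≤ r / (δ / n) :=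
      div_le_div_of_nonneg_left hr.le hη (div_le_self hδ'.le hn')
    linarith [(Nat.cast_nonneg ρ : (0 : ℝ) ≤ ρ)]
  calc (r / δ) ^ k ≤ (2 * ρ + 1) ^ k := by gcongr
    _ ≤ (2 * n + 5) ^ n * N := by exact_mod_cast h1.trans h2

/-- The upper bound for the covering numbers of a set of centres. -/
theorem externalCoveringNumber_pow_le {n k : ℕ} (hk : k < n) :
    ∃ C : ℕ, ∀ (B S : Set (EuclideanSpace ℝ (Fin n))) (δ : ℝ≥0) (N J : ℕ), 0 < δ → 0 < J →
      (∀ x ∈ S, ∃ r : ℝ, 0 < r ∧ r / (δ / n) < 2 ^ J ∧ cubeSkeleton k x r ⊆ B) →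
      externalCoveringNumber δ B ≤ N →
      ∃ M : ℕ, externalCoveringNumber δ S ≤ M ∧
        M ^ (2 * n ^ 2 - (n - k)) ≤ (C * J) ^ (2 * n ^ 2 - (n - k)) * N ^ (2 * n ^ 2) := by
  have hn : 0 < n := by omega
  have hn' : (0 : ℝ) < n := by exact_mod_cast hn
  have : Nonempty (Fin n) := ⟨⟨0, hn⟩⟩
  obtain ⟨C, hC⟩ := card_pow_le_of_discrete_skeletons (ι := Fin n) (k := k) (by simpa using hk)
  simp only [Fintype.card_fin] at hC
  have hP : 0 < 2 * n ^ 2 - (n - k) := by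
    have : n ≤ n ^ 2 := Nat.le_self_pow (by norm_num) n
    omega
  set P := 2 * n ^ 2 - (n - k) with hPdef
  refine ⟨C * ((2 * n + 5) ^ n) ^ (2 * n ^ 2), fun B S δ N J hδ hJ hS hN => ?_⟩
  have hδ' : (0 : ℝ) < δ := by exact_mod_cast hδ
  have hη : (0 : ℝ) < δ / n := by positivity
  have hfin := gridNear_finite hn hδ hN
  have hcard := card_le_of_subset_gridNear hn hδ hN (B := hfin.toFinset) (by simp)
  set K := (C * ((2 * n + 5) ^ n) ^ (2 * n ^ 2) * J) ^ P * N ^ (2 * n ^ 2) with hK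
  -- The bound is first shown for finite sets of rounded centres, because the finiteness of the
  -- whole set is deduced from it.
  have hbound : ∀ A : Finset (Fin n → ℤ), (A : Set (Fin n → ℤ)) ⊆ gridFloor (δ / n) '' S →
      A.card ^ P ≤ K := by
    intro A hA
    have hA' : ∀ a ∈ A, ∃ x, x ∈ S ∧ gridFloor (δ / n) x = a := fun a ha => hA ha
    choose! x hxS hxa using hA'
    choose! r hr hrJ hrB using hS
    have h0 := hC A hfin.toFinset (fun a => ⌊r (x a) / (δ / n)⌋₊) J ?_ ?_
    · refine h0.trans ?_
      calc (C * J) ^ P * hfin.toFinset.card ^ (2 * n ^ 2)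
          ≤ (C * J) ^ P * ((2 * n + 5) ^ n * N) ^ (2 * n ^ 2) := by gcongr
        _ = (C * J) ^ P * ((2 * n + 5) ^ n) ^ (2 * n ^ 2) * N ^ (2 * n ^ 2) := by
            rw [mul_pow ((2 * n + 5) ^ n), mul_assoc]
        _ ≤ (C * J) ^ P * (((2 * n + 5) ^ n) ^ (2 * n ^ 2)) ^ P * N ^ (2 * n ^ 2) := by
            exact Nat.mul_le_mul_right _ (Nat.mul_le_mul_left _ (Nat.le_self_pow hP.ne' _))
        _ = K := by rw [hK, ← mul_pow]; congr 2; ring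
    · intro a ha
      have h1 := hrJ _ (hxS a ha)
      have h2 : ⌊r (x a) / (δ / n)⌋₊ < 2 ^ J := by
        rw [Nat.floor_lt (div_nonneg (hr _ (hxS a ha)).le hη.le)]
        exact_mod_cast h1
      by_cases h3 : ⌊r (x a) / (δ / n)⌋₊ = 0
      · rw [h3]; simpa using hJ
      · exact Nat.log_lt_of_lt_pow h3 h2
    · intro a ha U hU b hbU hb
      rw [Set.Finite.mem_toFinset]
      refine mem_gridNear_of_cubeSkeleton_subset hk.le hη (hr _ (hxS a ha)) (hrB _ (hxS a ha)) hU ?_ ?_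
      · rw [hxa a ha]; exact hbU
      · rw [hxa a ha]; exact hb
  have hAfin : (gridFloor (δ / n) '' S).Finite := by
    by_contra hinf
    obtain ⟨A, hA, hAcard⟩ := Set.Infinite.exists_subset_card_eq hinf (K + 1)
    have h1 := hbound A hA
    have h2 := Nat.le_self_pow hP.ne' A.card
    omega
  refine ⟨hAfin.toFinset.card, ?_, hbound _ (by simp)⟩
  refine externalCoveringNumber_le_card_of_gridFloor_mem hn hδ fun x hx => ?_
  rw [Set.Finite.mem_toFinset]
  exact Set.mem_image_of_mem _ hx

/-! ### Box dimensions. -/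

theorem ereal_le_of_forall_pos_le_add {a b : EReal} (h : ∀ ε : ℝ, 0 < ε → a ≤ b + ε) : a ≤ b := by
  rw [← EReal.le_of_forall_lt_iff_le]
  intro z hz
  induction b with
  | bot => exact (h 1 one_pos).trans (by simp)
  | top => exact absurd hz (by simp)
  | coe b =>
    have hbz : b < z := by exact_mod_cast hz
    refine (h (z - b) (by linarith)).trans ?_
    rw [← EReal.coe_add]
    exact_mod_cast (by linarith : b + (z - b) ≤ z)

theorem limsup_le_limsup_of_eventually_le_add {α : Type*} {l : Filter α} [l.NeBot]
    {f g : α → EReal} (h : ∀ ε : ℝ, 0 < ε → ∀ᶠ x in l, f x ≤ g x + ε) :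
    limsup f l ≤ limsup g l := by
  refine ereal_le_of_forall_pos_le_add fun ε hε => (limsup_le_limsup (h ε hε)).trans ?_
  refine (EReal.limsup_add_le (u := g) (v := fun _ => (ε : EReal)) ?_ ?_).trans_eq ?_ <;> simp

theorem liminf_le_liminf_of_eventually_le_add {α : Type*} {l : Filter α} [l.NeBot]
    {f g : α → EReal} (h : ∀ ε : ℝ, 0 < ε → ∀ᶠ x in l, f x ≤ g x + ε) :
    liminf f l ≤ liminf g l := by
  refine ereal_le_of_forall_pos_le_add fun ε hε => (liminf_le_liminf (h ε hε)).trans ?_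
  have := EReal.liminf_add_le (u := fun _ : α => (ε : EReal)) (v := g) (f := l) (by simp) (by simp)
  rw [limsup_const] at this
  rw [add_comm]
  refine le_trans (le_of_eq ?_) this
  congr 1
  funext x
  exact add_comm _ _

theorem eventually_neg_log_ge (Λ : ℝ) :
    ∀ᶠ δ : ℝ≥0 in 𝓝[>] 0, 0 < δ ∧ Λ ≤ -Real.log δ := by
  have hpos : (0 : ℝ≥0) < ⟨Real.exp (-Λ), (Real.exp_pos _).le⟩ := Real.exp_pos _
  filter_upwards [Ioo_mem_nhdsGT hpos] with δ hδ
  refine ⟨hδ.1, ?_⟩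
  have h1 : (0 : ℝ) < δ := by exact_mod_cast hδ.1
  have h2 : (δ : ℝ) < Real.exp (-Λ) := hδ.2
  have h3 := Real.log_lt_log h1 h2
  rw [Real.log_exp] at h3
  linarith

theorem boxQuotient_eq_top {X : Type*} [PseudoEMetricSpace X] {A : Set X} {δ : ℝ≥0}
    (hlog : 0 < -Real.log (δ : ℝ)) (h : externalCoveringNumber δ A = ⊤) : boxQuotient A δ = ⊤ := by
  rw [boxQuotient, h]
  simp only [ENat.toENNReal_top, ENNReal.log_top]
  exact EReal.top_div_of_pos_ne_top (by exact_mod_cast hlog) (EReal.coe_ne_top _)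

theorem log_natCast_enat {N : ℕ} (hN : 0 < N) :
    ENNReal.log (((N : ℕ∞) : ℝ≥0∞)) = (Real.log N : ℝ) := by
  have h := ENNReal.log_of_nnreal (x := (N : ℝ≥0)) (by exact_mod_cast hN.ne')
  simpa using h

theorem boxQuotient_eq_coe {X : Type*} [PseudoEMetricSpace X] {A : Set X} {δ : ℝ≥0} {N : ℕ}
    (hN : 0 < N) (h : externalCoveringNumber δ A = N) :
    boxQuotient A δ = ((Real.log N / -Real.log δ : ℝ) : EReal) := by
  rw [boxQuotient, h, log_natCast_enat hN, EReal.coe_div]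

theorem boxQuotient_le_coe {X : Type*} [PseudoEMetricSpace X] {A : Set X} {δ : ℝ≥0} {N : ℕ}
    (hlog : 0 < -Real.log (δ : ℝ)) (hN : 0 < N) (h : externalCoveringNumber δ A ≤ N) :
    boxQuotient A δ ≤ ((Real.log N / -Real.log δ : ℝ) : EReal) := by
  rw [boxQuotient, EReal.coe_div, ← log_natCast_enat hN]
  refine EReal.div_le_div_right_of_nonneg (by exact_mod_cast hlog.le) (ENNReal.log_monotone ?_)
  exact_mod_cast h

theorem exists_mem_cubeSkeleton_le_dist {n k : ℕ} (hk : k < n) (x : EuclideanSpace ℝ (Fin n)) {r : ℝ}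
    (hr : 0 < r) : ∃ y ∈ cubeSkeleton k x r, ∃ z ∈ cubeSkeleton k x r, r ≤ dist y z := by
  obtain ⟨I, -, hI⟩ := Finset.exists_subset_card_eq (s := (Finset.univ : Finset (Fin n)))
    (n := k) (by simpa using hk.le)
  let y : EuclideanSpace ℝ (Fin n) := WithLp.toLp 2 fun i => x i - r
  let z : EuclideanSpace ℝ (Fin n) := WithLp.toLp 2 fun i => x i + r
  refine ⟨y, ⟨I, hI, fun i _ => ?_, fun i _ => Or.inl rfl⟩, z,
    ⟨I, hI, fun i _ => ?_, fun i _ => Or.inr rfl⟩, ?_⟩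
  · simp only [y, Set.mem_Icc]; constructor <;> linarith
  · simp only [z, Set.mem_Icc]; constructor <;> linarith
  · have h := abs_sub_apply_le_dist y z ⟨0, by omega⟩
    have e : |y ⟨0, by omega⟩ - z ⟨0, by omega⟩| = 2 * r := by
      rw [show y ⟨0, by omega⟩ - z ⟨0, by omega⟩ = -(2 * r) by simp only [y, z]; ring, abs_neg,
        abs_of_pos (by linarith)]
    linarith

theorem isBounded_of_externalCoveringNumber_ne_top {X : Type*} [PseudoMetricSpace X] {F : Set X}
    {δ : ℝ≥0} (h : externalCoveringNumber δ F ≠ ⊤) : Bornology.IsBounded F := by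
  obtain ⟨N, hN⟩ := ENat.ne_top_iff_exists.1 h
  obtain ⟨C, hC, -⟩ := exists_isCover_of_externalCoveringNumber_le hN.symm.le
  refine ((Bornology.isBounded_biUnion_finset C).2 fun c _ => isBounded_closedBall
    (x := c) (r := δ)).subset fun y hy => ?_
  obtain ⟨c, hc, hyc⟩ := hC hy
  refine Set.mem_biUnion (Finset.mem_coe.1 hc) ?_
  have : edist y c ≤ δ := hyc
  rw [edist_nndist] at this
  rw [mem_closedBall, ← coe_nndist]
  exact_mod_cast this

/-- One skeleton of fixed half side `r` already forces about `(r / δ) ^ k` balls; the constants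
vanish after division by `-log δ`. -/
theorem natCast_le_boxQuotient_add {n k : ℕ} (hk : k < n) {r : ℝ} (hr : 0 < r)
    {x : EuclideanSpace ℝ (Fin n)} {B : Set (EuclideanSpace ℝ (Fin n))}
    (hB : cubeSkeleton k x r ⊆ B) {ε : ℝ} (hε : 0 < ε) :
    ∀ᶠ δ in 𝓝[>] (0 : ℝ≥0), ((k : ℝ) : EReal) ≤ boxQuotient B δ + ε := by
  set c : ℝ := (2 * n + 5) ^ n with hc
  have hc0 : 0 < c := by positivity
  filter_upwards [eventually_neg_log_ge (max 1 ((Real.log c - k * Real.log r) / ε))]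
    with δ ⟨hδ, hΛ⟩
  have hL1 := (le_max_left _ _).trans hΛ
  have hL2 := (le_max_right _ _).trans hΛ
  have hδ' : (0 : ℝ) < δ := by exact_mod_cast hδ
  by_cases htop : externalCoveringNumber δ B = ⊤
  · rw [boxQuotient_eq_top (by linarith) htop, EReal.top_add_coe]
    exact le_top
  obtain ⟨N, hN⟩ := ENat.ne_top_iff_exists.1 htop
  have hpow := pow_le_of_cubeSkeleton_subset hk hδ hr hB hN.symm.le
  have hNpos : 0 < N := by
    rcases Nat.eq_zero_or_pos N with h | h
    · rw [h, Nat.cast_zero, mul_zero] at hpow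
      exact absurd hpow (not_le.2 (by positivity))
    · exact h
  rw [boxQuotient_eq_coe hNpos hN.symm, ← EReal.coe_add, EReal.coe_le_coe_iff]
  have hlog := Real.log_le_log (by positivity) hpow
  rw [Real.log_pow, Real.log_div hr.ne' hδ'.ne', Real.log_mul hc0.ne' (by positivity)] at hlog
  rw [div_le_iff₀ hε] at hL2
  have hL : 0 < -Real.log (δ : ℝ) := by linarith
  rw [← sub_le_iff_le_add, le_div_iff₀ hL]
  linarith

theorem mul_log_add_le_eventually (a b : ℝ) (ha : 0 < a) (hb : 0 < b) {ε : ℝ} (hε : 0 < ε) :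
    ∃ Λ : ℝ, 1 ≤ Λ ∧ ∀ L, Λ ≤ L → Real.log (a * L + b) ≤ ε * L := by
  -- From `log (e * y) ≤ e * y - 1`, this `e` leaves the slope `ε / 2`, and the other half of `ε *
  -- L` absorbs the constants.
  set e := ε / (2 * a) with he
  have he0 : 0 < e := by positivity
  refine ⟨max 1 ((e * b - Real.log e) * 2 / ε), le_max_left _ _, fun L hL => ?_⟩
  have h1 := (le_max_left _ _).trans hL
  have h2 := (le_max_right _ _).trans hL
  rw [div_le_iff₀ hε] at h2
  have h3 : 0 < a * L + b := by nlinarith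
  have h4 := Real.log_le_sub_one_of_pos (mul_pos he0 h3)
  rw [Real.log_mul he0.ne' h3.ne'] at h4
  have h5 : e * a = ε / 2 := by rw [he]; field_simp
  have h6 : e * (a * L + b) = ε / 2 * L + e * b := by rw [← h5]; ring
  linarith

/-- The number of dyadic scales between `δ` and a fixed length grows like `log (1 / δ)`. -/
theorem natLog_ceil_div_le {K : ℝ} (hK : 0 < K) {δ : ℝ} (hδ : 0 < δ) (hδ1 : 1 ≤ -Real.log δ) :
    ((Nat.log 2 ⌈K / δ⌉₊ + 1 : ℕ) : ℝ) ≤ 2 * -Real.log δ + (2 * Real.log (K + 1) + 1) := by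
  have hδ2 : δ < 1 := by
    by_contra! h
    linarith [Real.log_nonneg h]
  have h1 : (⌈K / δ⌉₊ : ℝ) ≤ (K + 1) / δ := by
    refine (Nat.ceil_lt_add_one (by positivity)).le.trans ?_
    rw [add_div]
    gcongr
    rw [le_div_iff₀ hδ]
    linarith
  have hpos : 0 < ⌈K / δ⌉₊ := Nat.ceil_pos.2 (by positivity)
  have h2 : (Nat.log 2 ⌈K / δ⌉₊ : ℝ) * Real.log 2 ≤ Real.log ⌈K / δ⌉₊ := by
    rw [← Real.log_pow]
    refine Real.log_le_log (by positivity) ?_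
    exact_mod_cast Nat.pow_log_le_self 2 hpos.ne'
  have h3 : Real.log ⌈K / δ⌉₊ ≤ Real.log (K + 1) - Real.log δ := by
    rw [← Real.log_div (by positivity) hδ.ne']
    exact Real.log_le_log (by exact_mod_cast hpos) h1
  -- The factor 2 in the conclusion comes from `log 2 > 1 / 2`.
  have h4 := Real.log_two_gt_d9
  have h5 : (0 : ℝ) ≤ Nat.log 2 ⌈K / δ⌉₊ := Nat.cast_nonneg _
  push_cast
  nlinarith

/-- If `B` is unbounded, its quotient is `⊤`. Otherwise the half sides are bounded, since each
skeleton contains two points at distance at least `r`. Then only `O(log (1/δ))` dyadic scales occur,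
and the logarithm of their number is `o(log (1/δ))`. -/
theorem mul_boxQuotient_le_boxQuotient_add {n k : ℕ} (hk : k < n)
    {B S : Set (EuclideanSpace ℝ (Fin n))} (hS : S.Nonempty)
    (hB : ∀ x ∈ S, ∃ r : ℝ, 0 < r ∧ cubeSkeleton k x r ⊆ B) {ε : ℝ} (hε : 0 < ε) :
    ∀ᶠ δ in 𝓝[>] (0 : ℝ≥0), ((1 - ((n : ℝ) - k) / (2 * (n : ℝ) ^ 2) : ℝ) : EReal) *
      boxQuotient S δ ≤ boxQuotient B δ + ε := by
  have hn : 0 < n := by omega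
  have hn' : (0 : ℝ) < n := by exact_mod_cast hn
  by_cases hbdd : Bornology.IsBounded B
  swap
  · filter_upwards [eventually_neg_log_ge 1] with δ ⟨hδ, hΛ⟩
    have htop : externalCoveringNumber δ B = ⊤ := by
      by_contra h
      exact hbdd (isBounded_of_externalCoveringNumber_ne_top h)
    rw [boxQuotient_eq_top (by linarith) htop, EReal.top_add_coe]
    exact le_top
  obtain ⟨K, hK0, hK⟩ := hbdd.exists_pos_norm_le
  obtain ⟨C, hC⟩ := externalCoveringNumber_pow_le hk
  have hlt : n - k < 2 * n ^ 2 := by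
    have : n ≤ n ^ 2 := Nat.le_self_pow (by norm_num) n
    omega
  obtain ⟨P, hP, hPpos⟩ : ∃ P, 2 * n ^ 2 - (n - k) = P ∧ 0 < P := ⟨_, rfl, by omega⟩
  obtain ⟨D, hD⟩ : ∃ D, 2 * n ^ 2 = D := ⟨_, rfl⟩
  have hDpos : 0 < D := by rw [← hD]; positivity
  rw [hP, hD] at hC
  have hcoef : (1 - ((n : ℝ) - k) / (2 * (n : ℝ) ^ 2) : ℝ) = P / D := by
    rw [← hP, ← hD, Nat.cast_sub hlt.le, Nat.cast_sub hk.le]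
    push_cast
    field_simp
  rw [hcoef]
  have hPD : (P : ℝ) / D ≤ 1 := by
    rw [div_le_one (by exact_mod_cast hDpos)]
    exact_mod_cast (by omega : P ≤ D)
  set K' : ℝ := (2 * K + 1) * n with hK'
  have hK'pos : 0 < K' := by positivity
  have hlogK' : 0 ≤ Real.log (K' + 1) := Real.log_nonneg (by linarith)
  obtain ⟨Λ, hΛ1, hΛ⟩ := mul_log_add_le_eventually ((C + 1) * 2)
    ((C + 1) * (2 * Real.log (K' + 1) + 1)) (by positivity) (by positivity) hε
  filter_upwards [eventually_neg_log_ge Λ] with δ ⟨hδ, hL⟩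
  have hδ' : (0 : ℝ) < δ := by exact_mod_cast hδ
  have hL1 : 1 ≤ -Real.log (δ : ℝ) := hΛ1.trans hL
  by_cases htop : externalCoveringNumber δ B = ⊤
  · rw [boxQuotient_eq_top (by linarith) htop, EReal.top_add_coe]
    exact le_top
  obtain ⟨N, hN⟩ := ENat.ne_top_iff_exists.1 htop
  set J := Nat.log 2 ⌈K' / (δ : ℝ)⌉₊ + 1 with hJ
  have hscale : ∀ x ∈ S, ∃ r : ℝ, 0 < r ∧ r / (δ / n) < 2 ^ J ∧ cubeSkeleton k x r ⊆ B := by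
    intro x hx
    obtain ⟨r, hr, hrB⟩ := hB x hx
    refine ⟨r, hr, ?_, hrB⟩
    obtain ⟨y, hy, z, hz, hyz⟩ := exists_mem_cubeSkeleton_le_dist hk x hr
    have hrK : r ≤ 2 * K + 1 := by
      have := dist_le_norm_add_norm y z
      linarith [hK y (hrB hy), hK z (hrB hz)]
    calc r / (δ / n) ≤ K' / δ := by
          rw [div_div_eq_mul_div, hK']
          gcongr
      _ ≤ (⌈K' / (δ : ℝ)⌉₊ : ℝ) := Nat.le_ceil _
      _ < 2 ^ J := by exact_mod_cast Nat.lt_pow_succ_log_self (by norm_num) _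
  obtain ⟨M, hM, hMN⟩ := hC B S δ N J hδ (Nat.succ_pos _) hscale hN.symm.le
  have hMpos : 0 < M := by
    have h := (externalCoveringNumber_pos_iff (ε := δ)).2 hS
    have h2 := h.trans_le hM
    exact_mod_cast h2
  have hprod : 0 < (C * J) ^ P * N ^ D := (pow_pos hMpos P).trans_le hMN
  have hCJpos : 0 < C * J := by
    rcases Nat.eq_zero_or_pos (C * J) with h | h
    · rw [h, zero_pow hPpos.ne', zero_mul] at hprod
      exact absurd hprod (lt_irrefl _)
    · exact h
  have hNpos : 0 < N := by
    rcases Nat.eq_zero_or_pos N with h | h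
    · rw [h, zero_pow hDpos.ne', mul_zero] at hprod
      exact absurd hprod (lt_irrefl _)
    · exact h
  have hL0 : 0 < -Real.log (δ : ℝ) := by linarith
  have hCJ0 : 0 ≤ Real.log ((C : ℝ) * J) := Real.log_nonneg (by exact_mod_cast hCJpos)
  have hDpos' : (0 : ℝ) < D := by exact_mod_cast hDpos
  have hlog : P / D * Real.log M ≤ Real.log (C * J) + Real.log N := by
    have h1 : (M : ℝ) ^ P ≤ ((C : ℝ) * J) ^ P * (N : ℝ) ^ D := by exact_mod_cast hMN
    have h2 := Real.log_le_log (by positivity) h1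
    have h3 : ((C : ℝ) * J) ≠ 0 := by exact_mod_cast hCJpos.ne'
    rw [Real.log_mul (pow_ne_zero _ h3) (by positivity), Real.log_pow, Real.log_pow,
      Real.log_pow] at h2
    have h4 : P / D * Real.log M ≤ P / D * Real.log (C * J) + Real.log N := by
      rw [div_mul_eq_mul_div, div_mul_eq_mul_div, ← sub_le_iff_le_add', ← sub_div,
        div_le_iff₀ hDpos']
      linarith
    -- Since `P / D ≤ 1` and `log (C * J) ≥ 0`, the factor on `log (C * J)` can be dropped.
    nlinarith
  have hCJ : Real.log (C * J) ≤ ε * -Real.log (δ : ℝ) := by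
    refine le_trans (Real.log_le_log (by exact_mod_cast hCJpos) ?_) (hΛ _ hL)
    have h1 := natLog_ceil_div_le hK'pos hδ' hL1
    rw [← hJ] at h1
    calc (C : ℝ) * J ≤ (C + 1) * J := by gcongr; linarith
      _ ≤ (C + 1) * (2 * -Real.log (δ : ℝ) + (2 * Real.log (K' + 1) + 1)) := by gcongr
      _ = _ := by ring
  calc (((P : ℝ) / D : ℝ) : EReal) * boxQuotient S δ
      ≤ (((P : ℝ) / D : ℝ) : EReal) * ((Real.log M / -Real.log δ : ℝ) : EReal) :=
        mul_le_mul_of_nonneg_left (boxQuotient_le_coe hL0 hMpos hM)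
          (by exact_mod_cast (by positivity : (0 : ℝ) ≤ P / D))
    _ ≤ _ := by
        rw [boxQuotient_eq_coe hNpos hN.symm, ← EReal.coe_mul, ← EReal.coe_add,
          EReal.coe_le_coe_iff, ← mul_div_assoc, ← sub_le_iff_le_add', ← sub_div,
          div_le_iff₀ hL0]
        linarith

theorem max_le_boxDims {n k : ℕ} (hk : k < n) {B S : Set (EuclideanSpace ℝ (Fin n))}
    (hS : S.Nonempty) (hB : ∀ x ∈ S, ∃ r : ℝ, 0 < r ∧ cubeSkeleton k x r ⊆ B) :
    max ((k : ℝ) : EReal)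
        (((1 - ((n : ℝ) - k) / (2 * (n : ℝ) ^ 2) : ℝ) : EReal) * upperBoxDim S)
      ≤ upperBoxDim B ∧
    max ((k : ℝ) : EReal)
        (((1 - ((n : ℝ) - k) / (2 * (n : ℝ) ^ 2) : ℝ) : EReal) * lowerBoxDim S)
      ≤ lowerBoxDim B := by
  obtain ⟨x, hx⟩ := hS
  obtain ⟨r, hr, hrB⟩ := hB x hx
  have hcoef : (0 : ℝ) ≤ 1 - ((n : ℝ) - k) / (2 * (n : ℝ) ^ 2) := by
    have h1 : (1 : ℝ) ≤ n := by exact_mod_cast (by omega : 1 ≤ n)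
    rw [sub_nonneg, div_le_one (by positivity)]
    nlinarith [(Nat.cast_nonneg k : (0 : ℝ) ≤ k)]
  have hcoef' : (0 : EReal) ≤ ((1 - ((n : ℝ) - k) / (2 * (n : ℝ) ^ 2) : ℝ) : EReal) := by
    exact_mod_cast hcoef
  have h1 := fun ε (hε : (0 : ℝ) < ε) => natCast_le_boxQuotient_add hk hr hrB hε
  have h2 := fun ε (hε : (0 : ℝ) < ε) => mul_boxQuotient_le_boxQuotient_add hk ⟨x, hx⟩ hB hε
  constructor <;> refine max_le ?_ ?_
  · simpa [upperBoxDim] using limsup_le_limsup_of_eventually_le_add h1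
  · rw [upperBoxDim, ← EReal.limsup_const_mul_of_nonneg_of_ne_top hcoef' (EReal.coe_ne_top _)]
    exact limsup_le_limsup_of_eventually_le_add h2
  · simpa [lowerBoxDim] using liminf_le_liminf_of_eventually_le_add h1
  · rw [lowerBoxDim, ← EReal.liminf_const_mul_of_nonneg_of_ne_top hcoef' (EReal.coe_ne_top _)]
    exact liminf_le_liminf_of_eventually_le_add h2

/-! ### Packing pre-measures and covering numbers. -/

/-- The covering numbers of `F` at small scales `δ` are at most a constant times `δ ^ (-t)`. -/
def CoverBound {X : Type*} [PseudoEMetricSpace X] (t : ℝ) (F : Set X) : Prop :=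
  ∃ C : ℝ, 0 ≤ C ∧ ∃ δ₀ : ℝ≥0, 0 < δ₀ ∧ ∀ δ : ℝ≥0, 0 < δ → δ ≤ δ₀ →
    ∃ N : ℕ, externalCoveringNumber δ F ≤ N ∧ (N : ℝ) ≤ C * (δ : ℝ) ^ (-t)

/-- A finite union of closed balls is closed. Passing to closures at no cost makes the Baire
argument available. -/
theorem externalCoveringNumber_closure_le {X : Type*} [PseudoMetricSpace X] {δ : ℝ≥0} {F : Set X}
    {N : ℕ} (h : externalCoveringNumber δ F ≤ N) : externalCoveringNumber δ (closure F) ≤ N := by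
  obtain ⟨C, hC, hCN⟩ := exists_isCover_of_externalCoveringNumber_le h
  have hcov : IsCover δ (closure F) (C : Set X) := by
    have hclosed : IsClosed (⋃ c ∈ C, closedBall c (δ : ℝ)) :=
      C.finite_toSet.isClosed_biUnion fun c _ => isClosed_closedBall
    have hsub : F ⊆ ⋃ c ∈ C, closedBall c (δ : ℝ) := by
      intro y hy
      obtain ⟨c, hc, hyc⟩ := hC hy
      refine Set.mem_biUnion (Finset.mem_coe.1 hc) ?_
      have : edist y c ≤ δ := hyc
      rw [edist_nndist] at this
      rw [mem_closedBall, ← coe_nndist]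
      exact_mod_cast this
    intro y hy
    obtain ⟨c, hc, hyc⟩ := Set.mem_iUnion₂.1 (closure_minimal hsub hclosed hy)
    refine ⟨c, Finset.mem_coe.2 hc, ?_⟩
    change edist y c ≤ δ
    rw [edist_nndist]
    rw [mem_closedBall, ← coe_nndist] at hyc
    exact_mod_cast hyc
  refine hcov.externalCoveringNumber_le_encard.trans ?_
  rw [Set.encard_coe_eq_coe_finsetCard]
  exact_mod_cast hCN

theorem CoverBound.closure {X : Type*} [PseudoMetricSpace X] {t : ℝ} {F : Set X}
    (h : CoverBound t F) : CoverBound t (closure F) := by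
  obtain ⟨C, hC, δ₀, hδ₀, h⟩ := h
  refine ⟨C, hC, δ₀, hδ₀, fun δ hδ hδ' => ?_⟩
  obtain ⟨N, hN, hNC⟩ := h δ hδ hδ'
  exact ⟨N, externalCoveringNumber_closure_le hN, hNC⟩

theorem CoverBound.union {X : Type*} [PseudoMetricSpace X] {t : ℝ} {F G : Set X}
    (hF : CoverBound t F) (hG : CoverBound t G) : CoverBound t (F ∪ G) := by
  classical
  obtain ⟨C, hC, δ₀, hδ₀, hF⟩ := hF
  obtain ⟨C', hC', δ₁, hδ₁, hG⟩ := hG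
  refine ⟨C + C', add_nonneg hC hC', min δ₀ δ₁, lt_min hδ₀ hδ₁, fun δ hδ hδ' => ?_⟩
  obtain ⟨N, hN, hNC⟩ := hF δ hδ (hδ'.trans (min_le_left _ _))
  obtain ⟨N', hN', hNC'⟩ := hG δ hδ (hδ'.trans (min_le_right _ _))
  refine ⟨N + N', ?_, by push_cast; linarith⟩
  obtain ⟨c, hc, hcN⟩ := exists_isCover_of_externalCoveringNumber_le hN
  obtain ⟨c', hc', hcN'⟩ := exists_isCover_of_externalCoveringNumber_le hN'
  have hcov : IsCover δ (F ∪ G) ((c ∪ c' : Finset X) : Set X) := by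
    rintro y (hy | hy)
    · obtain ⟨p, hp, h⟩ := hc hy
      exact ⟨p, by simp [Finset.mem_coe.1 hp], h⟩
    · obtain ⟨p, hp, h⟩ := hc' hy
      exact ⟨p, by simp [Finset.mem_coe.1 hp], h⟩
  refine hcov.externalCoveringNumber_le_encard.trans ?_
  rw [Set.encard_coe_eq_coe_finsetCard]
  exact_mod_cast (Finset.card_union_le _ _).trans (add_le_add hcN hcN')

theorem CoverBound.biUnion_finset {X ι : Type*} [PseudoMetricSpace X] {t : ℝ} {F : ι → Set X}
    (s : Finset ι) (h : ∀ i ∈ s, CoverBound t (F i)) : CoverBound t (⋃ i ∈ s, F i) := by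
  classical
  induction s using Finset.induction with
  | empty =>
    refine ⟨0, le_rfl, 1, one_pos, fun δ _ _ => ⟨0, by simp, by simp⟩⟩
  | insert a s _ ih =>
    rw [Finset.set_biUnion_insert]
    exact (h a (Finset.mem_insert_self a s)).union
      (ih fun i hi => h i (Finset.mem_insert_of_mem hi))

/-- Balls of radius `δ / 2` about points more than `δ` apart are disjoint, and each contributes `δ ^
t`. -/
theorem card_mul_rpow_le_packingSum {X : Type*} [PseudoMetricSpace X] (t : ℝ) {δ δ₀ : ℝ≥0}
    (hδ : 0 < δ) (hδ₀ : δ ≤ δ₀) {F : Set X} (E : Finset X) (hE : (E : Set X) ⊆ F)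
    (hsep : (E : Set X).Pairwise fun x y => (δ : ℝ) < dist x y) :
    (E.card : ℝ≥0∞) * (δ : ℝ≥0∞) ^ t ≤ packingSum t δ₀ F := by
  classical
  have hcond : (∀ p ∈ E ×ˢ ({δ / 2} : Finset ℝ≥0), p.1 ∈ F ∧ 0 < p.2 ∧ p.2 ≤ δ₀) ∧
      ((E ×ˢ ({δ / 2} : Finset ℝ≥0) : Finset (X × ℝ≥0)) : Set (X × ℝ≥0)).PairwiseDisjoint
        (fun p => closedBall p.1 (p.2 : ℝ)) := by
    constructor
    · intro p hp
      rw [Finset.mem_product, Finset.mem_singleton] at hp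
      refine ⟨hE hp.1, by rw [hp.2]; positivity, ?_⟩
      rw [hp.2]
      exact (half_le_self zero_le).trans hδ₀
    · intro p hp q hq hpq
      rw [Finset.mem_coe, Finset.mem_product, Finset.mem_singleton] at hp hq
      have hne : p.1 ≠ q.1 := fun h => hpq (Prod.ext h (hp.2.trans hq.2.symm))
      refine closedBall_disjoint_closedBall ?_
      rw [hp.2, hq.2]
      have := hsep (Finset.mem_coe.2 hp.1) (Finset.mem_coe.2 hq.1) hne
      push_cast
      linarith
  refine le_trans (le_of_eq ?_) (le_iSup₂_of_le (E ×ˢ ({δ / 2} : Finset ℝ≥0)) hcond le_rfl)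
  rw [Finset.sum_product]
  simp only [Finset.sum_singleton, Finset.sum_const, nsmul_eq_mul]
  rw [mul_div_cancel₀ δ (two_ne_zero)]

/-- Finiteness of the packing sum at one scale `δ₀` bounds the separated sets at all smaller scales,
and covering numbers are at most packing numbers. -/
theorem coverBound_of_packingPremeasure_ne_top {X : Type*} [PseudoMetricSpace X] {t : ℝ}
    {F : Set X} (h : packingPremeasure t F ≠ ∞) : CoverBound t F := by
  have h1 : packingPremeasure t F < ∞ := lt_top_iff_ne_top.2 h
  simp only [packingPremeasure, iInf_lt_iff] at h1
  obtain ⟨δ₀, hδ₀, hlt⟩ := h1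
  refine ⟨(packingSum t δ₀ F).toReal, ENNReal.toReal_nonneg, δ₀, hδ₀, fun δ hδ hδ' => ?_⟩
  have hδr : (0 : ℝ) < δ := by exact_mod_cast hδ
  set c := (packingSum t δ₀ F).toReal with hc
  have hbound : ∀ E : Finset X, (E : Set X) ⊆ F →
      (E : Set X).Pairwise (fun x y => (δ : ℝ) < dist x y) → (E.card : ℝ) ≤ c * (δ : ℝ) ^ (-t) := by
    intro E hE hsep
    have h2 := ENNReal.toReal_mono hlt.ne (card_mul_rpow_le_packingSum t hδ hδ' E hE hsep)
    rw [ENNReal.toReal_mul, ENNReal.toReal_natCast, ← ENNReal.toReal_rpow,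
      ENNReal.coe_toReal] at h2
    rw [Real.rpow_neg hδr.le, ← div_eq_mul_inv, le_div_iff₀ (by positivity)]
    exact h2
  refine ⟨⌊c * (δ : ℝ) ^ (-t)⌋₊, ?_, Nat.floor_le (by positivity)⟩
  refine (externalCoveringNumber_le_coveringNumber δ F).trans
    ((coveringNumber_le_packingNumber δ F).trans ?_)
  refine iSup_le fun E => iSup_le fun hE => iSup_le fun hsep => ?_
  by_contra! hcard
  have h3 : ((⌊c * (δ : ℝ) ^ (-t)⌋₊ + 1 : ℕ) : ℕ∞) ≤ E.encard := by
    push_cast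
    exact Order.add_one_le_of_lt hcard
  obtain ⟨E', hE', hE'card⟩ := Set.exists_subset_encard_eq h3
  have hfin : E'.Finite := Set.finite_of_encard_eq_coe hE'card
  have h4 := hbound hfin.toFinset (by simpa using hE'.trans hE) (by
    intro x hx y hy hxy
    rw [Set.Finite.coe_toFinset] at hx hy
    have h5 : (δ : ℝ≥0∞) < edist x y := hsep (hE' hx) (hE' hy) hxy
    rw [edist_nndist] at h5
    rw [← coe_nndist]
    exact_mod_cast h5)
  rw [hfin.encard_eq_coe_toFinset_card] at hE'card
  have h6 : hfin.toFinset.card = ⌊c * (δ : ℝ) ^ (-t)⌋₊ + 1 := by exact_mod_cast hE'card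
  have h7 := Nat.le_floor h4
  omega

/-- A polynomial bound for the cardinalities of separated sets bounds packing pre-measures. -/
theorem packingPremeasure_eq_zero_of_separated_bound {X : Type*} [PseudoMetricSpace X] {A : Set X}
    {u s : ℝ} (hus : u < s) (hs : 0 ≤ s) {C δ₀ : ℝ} (hC : 0 ≤ C) (hδ₀ : 0 < δ₀)
    (h : ∀ δ : ℝ, 0 < δ → δ ≤ δ₀ → ∀ E : Finset X, (E : Set X) ⊆ A →
      (E : Set X).Pairwise (fun x y => δ < dist x y) → (E.card : ℝ) ≤ C * δ ^ (-u)) :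
    packingPremeasure s A = 0 := by
  classical
  -- There are at most `C * 2 ^ ((j+1) u)` balls with radius in `(2 ^ (-j-1), 2 ^ (-j)]`, each
  -- contributing at most `2 ^ ((1-j) s)`. The product is `K * q ^ j`, a term of a convergent
  -- geometric series.
  set q : ℝ := (1 / 2) ^ (s - u) with hq
  have hq0 : 0 < q := by positivity
  have hq1 : q < 1 := Real.rpow_lt_one (by norm_num) (by norm_num) (by linarith)
  set K : ℝ := C * 2 ^ (u + s) with hK
  have hK0 : 0 ≤ K := by positivity
  obtain ⟨j₁, hj₁⟩ : ∃ j₁ : ℕ, (1 / 2 : ℝ) ^ j₁ < δ₀ :=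
    exists_pow_lt_of_lt_one hδ₀ (by norm_num)
  have hsum : ∀ j₀ : ℕ, j₁ ≤ j₀ →
      packingSum s ((1 / 2) ^ j₀) A ≤ ENNReal.ofReal (K * (q ^ j₀ * (1 - q)⁻¹)) := by
    intro j₀ hj₀
    refine iSup₂_le fun P hP => ?_
    obtain ⟨hP1, hP2⟩ := hP
    have hlevel : ∀ p ∈ P, ∃ j : ℕ, (1 / 2 : ℝ) ^ (j + 1) < p.2 ∧ (p.2 : ℝ) ≤ (1 / 2) ^ j ∧
        j₀ ≤ j := by
      intro p hp
      obtain ⟨-, hp0, hp1⟩ := hP1 p hp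
      have hp0' : (0 : ℝ) < p.2 := by exact_mod_cast hp0
      have hp1' : (p.2 : ℝ) ≤ (1 / 2) ^ j₀ := by exact_mod_cast hp1
      obtain ⟨j, hj1, hj2⟩ := exists_nat_pow_near_of_lt_one hp0'
        (hp1'.trans (pow_le_one₀ (by norm_num) (by norm_num))) (y := (1 / 2 : ℝ))
        (by norm_num) (by norm_num)
      refine ⟨j, hj1, hj2, ?_⟩
      have := hj1.trans_le hp1'
      rw [pow_lt_pow_iff_right_of_lt_one₀ (by norm_num) (by norm_num)] at this
      omega
    choose! lev hlev1 hlev2 hlev3 using hlevel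
    have hcount : ∀ j, j₀ ≤ j → ((P.filter fun p => lev p = j).card : ℝ) ≤
        C * ((1 / 2 : ℝ) ^ (j + 1)) ^ (-u) := by
      intro j hj
      -- Otherwise the centre of the second ball would lie in both balls.
      have hdist : ∀ p ∈ P, ∀ p' ∈ P, p ≠ p' → (p.2 : ℝ) < dist p'.1 p.1 := by
        intro p hp p' hp' hne
        by_contra! hle
        exact Set.disjoint_left.1 (hP2 (Finset.mem_coe.2 hp) (Finset.mem_coe.2 hp') hne)
          (mem_closedBall.2 hle) (mem_closedBall_self (NNReal.coe_nonneg _))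
      -- Balls are recorded with their radii, so concentric balls of different radii have to be
      -- excluded.
      have hinj : Set.InjOn Prod.fst ((P.filter fun p => lev p = j : Finset (X × ℝ≥0)) :
          Set (X × ℝ≥0)) := by
        intro p hp p' hp' he
        by_contra hne
        have h1 := hdist p (Finset.mem_filter.1 hp).1 p' (Finset.mem_filter.1 hp').1 hne
        rw [he, dist_self] at h1
        exact absurd h1 (not_lt.2 (NNReal.coe_nonneg _))
      rw [← Finset.card_image_of_injOn hinj]
      refine h _ (by positivity) ?_ _ ?_ ?_
      · exact (pow_le_pow_of_le_one (by norm_num) (by norm_num) (by omega)).trans hj₁.le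
      · intro x hx
        obtain ⟨p, hp, rfl⟩ := Finset.mem_image.1 hx
        exact (hP1 p (Finset.mem_filter.1 hp).1).1
      · intro x hx y hy hxy
        obtain ⟨p, hp, rfl⟩ := Finset.mem_image.1 hx
        obtain ⟨p', hp', rfl⟩ := Finset.mem_image.1 hy
        obtain ⟨hpP, hpj⟩ := Finset.mem_filter.1 hp
        obtain ⟨hpP', hpj'⟩ := Finset.mem_filter.1 hp'
        rw [dist_comm, ← hpj]
        exact (hlev1 p hpP).trans (hdist p hpP p' hpP' fun e => hxy (by rw [e]))
    have hreal : ∑ p ∈ P, ((2 * p.2 : ℝ≥0) : ℝ) ^ s ≤ K * (q ^ j₀ * (1 - q)⁻¹) := by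
      have hterm : ∀ j, j₀ ≤ j →
          ∑ p ∈ P.filter (fun p => lev p = j), ((2 * p.2 : ℝ≥0) : ℝ) ^ s ≤ K * q ^ j := by
        intro j hj
        calc ∑ p ∈ P.filter (fun p => lev p = j), ((2 * p.2 : ℝ≥0) : ℝ) ^ s
            ≤ ∑ _p ∈ P.filter (fun p => lev p = j), (2 * (1 / 2 : ℝ) ^ j) ^ s := by
              refine Finset.sum_le_sum fun p hp => ?_
              obtain ⟨hpP, hpj⟩ := Finset.mem_filter.1 hp
              refine Real.rpow_le_rpow (NNReal.coe_nonneg _) ?_ hs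
              push_cast
              rw [← hpj]
              linarith [hlev2 p hpP]
          _ = ((P.filter fun p => lev p = j).card : ℝ) * (2 * (1 / 2 : ℝ) ^ j) ^ s := by
              rw [Finset.sum_const, nsmul_eq_mul]
          _ ≤ C * ((1 / 2 : ℝ) ^ (j + 1)) ^ (-u) * (2 * (1 / 2 : ℝ) ^ j) ^ s := by
              gcongr
              exact hcount j hj
          _ = K * q ^ j := by
              have e1 : (1 / 2 : ℝ) = 2 ^ (-1 : ℝ) := by rw [Real.rpow_neg_one]; norm_num
              have e2 : (2 : ℝ) * (2 ^ (-1 : ℝ)) ^ j = 2 ^ (1 - j : ℝ) := by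
                rw [← Real.rpow_natCast, ← Real.rpow_mul (by norm_num),
                  sub_eq_add_neg, Real.rpow_add (by norm_num), Real.rpow_one]
                ring_nf
              rw [hK, hq, e1, e2]
              rw [← Real.rpow_natCast _ (j + 1), ← Real.rpow_natCast _ j]
              simp only [← Real.rpow_mul (show (0 : ℝ) ≤ 2 by norm_num)]
              rw [mul_assoc C, mul_assoc C, ← Real.rpow_add (by norm_num),
                ← Real.rpow_add (by norm_num)]
              congr 2
              push_cast
              ring
      set J := P.sup lev + 1 with hJ
      have hmaps : ∀ p ∈ P, lev p ∈ Finset.Ico j₀ J := by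
        intro p hp
        have := Finset.le_sup (f := lev) hp
        exact Finset.mem_Ico.2 ⟨hlev3 p hp, by omega⟩
      rw [← Finset.sum_fiberwise_of_maps_to hmaps]
      calc ∑ j ∈ Finset.Ico j₀ J, ∑ p ∈ P.filter (fun p => lev p = j), ((2 * p.2 : ℝ≥0) : ℝ) ^ s
          ≤ ∑ j ∈ Finset.Ico j₀ J, K * q ^ j :=
            Finset.sum_le_sum fun j hj => hterm j (Finset.mem_Ico.1 hj).1
        _ = K * ∑ j ∈ Finset.Ico j₀ J, q ^ j := by rw [Finset.mul_sum]
        _ ≤ K * (q ^ j₀ * (1 - q)⁻¹) := by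
            refine mul_le_mul_of_nonneg_left ?_ hK0
            rw [← div_eq_mul_inv]
            exact geom_sum_Ico_le_of_lt_one hq0.le hq1
    have hcoe : ∑ p ∈ P, ((2 * p.2 : ℝ≥0) : ℝ≥0∞) ^ s =
        ENNReal.ofReal (∑ p ∈ P, ((2 * p.2 : ℝ≥0) : ℝ) ^ s) := by
      rw [ENNReal.ofReal_sum_of_nonneg fun p _ => by positivity]
      refine Finset.sum_congr rfl fun p _ => ?_
      rw [← ENNReal.ofReal_rpow_of_nonneg (NNReal.coe_nonneg _) hs, ENNReal.ofReal_coe_nnreal]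
    rw [hcoe]
    exact ENNReal.ofReal_le_ofReal hreal
  have hlim : Tendsto (fun j : ℕ => ENNReal.ofReal (K * (q ^ j * (1 - q)⁻¹))) atTop (𝓝 0) := by
    have h1 : Tendsto (fun j : ℕ => K * (q ^ j * (1 - q)⁻¹)) atTop (𝓝 (K * (0 * (1 - q)⁻¹))) :=
      ((tendsto_pow_atTop_nhds_zero_of_lt_one hq0.le hq1).mul_const _).const_mul _
    simpa using ENNReal.tendsto_ofReal h1
  refine le_antisymm (ge_of_tendsto hlim ?_) zero_le
  filter_upwards [eventually_ge_atTop j₁] with j hj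
  exact (iInf₂_le ((1 / 2) ^ j) (by positivity)).trans (hsum j hj)

/-! ### Baire category on the faces of a cube. -/

/-- The point of the face of the cube with centre `x` and half side length `r` that is determined
by the set `U` of fixed coordinates, the signs `σ`, and the values `w` of the free coordinates. -/
noncomputable def facePoint {n : ℕ} (U : Finset (Fin n)) (σ : Fin n → ℤ)
    (x : EuclideanSpace ℝ (Fin n)) (r : ℝ) (w : Fin n → ℝ) : EuclideanSpace ℝ (Fin n) :=
  WithLp.toLp 2 fun i => if i ∈ U then x i + r * σ i else w i

theorem continuous_facePoint {n : ℕ} (U : Finset (Fin n)) (σ : Fin n → ℤ)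
    (x : EuclideanSpace ℝ (Fin n)) (r : ℝ) : Continuous (facePoint U σ x r) := by
  refine (PiLp.continuous_toLp 2 _).comp (continuous_pi fun i => ?_)
  by_cases hi : i ∈ U
  · simpa [hi] using continuous_const
  · simpa [hi] using continuous_apply i

theorem facePoint_mem_cubeSkeleton {n k : ℕ} (hk : k ≤ n) {U : Finset (Fin n)}
    (hU : U.card = n - k) {σ : Fin n → ℤ} (hσ : ∀ i, σ i = 1 ∨ σ i = -1)
    {x : EuclideanSpace ℝ (Fin n)} {r : ℝ} {w : Fin n → ℝ} (hw : ∀ i, |w i - x i| ≤ r) :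
    facePoint U σ x r w ∈ cubeSkeleton k x r := by
  refine ⟨Uᶜ, ?_, fun i hi => ?_, fun i hi => ?_⟩
  · rw [Finset.card_compl, Fintype.card_fin, hU]
    omega
  · rw [Finset.mem_compl] at hi
    have := abs_le.1 (hw i)
    simp only [facePoint, hi, if_false]
    constructor <;> linarith
  · rw [Finset.mem_compl, not_not] at hi
    simp only [facePoint, hi, if_true]
    rcases hσ i with h | h <;> rw [h]
    · right; simp
    · left; push_cast; ring

/-- If countably many closed sets cover the `k`-skeleton of a cube, then, by the Baire category
theorem, one of them contains a relatively open piece of a given face. -/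
theorem exists_facePoint_mem_of_iUnion {n k : ℕ} (hk : k ≤ n) {U : Finset (Fin n)}
    (hU : U.card = n - k) {σ : Fin n → ℤ} (hσ : ∀ i, σ i = 1 ∨ σ i = -1)
    {x : EuclideanSpace ℝ (Fin n)} {r : ℝ} (hr : 0 < r) {F : ℕ → Set (EuclideanSpace ℝ (Fin n))}
    (hF : ∀ i, IsClosed (F i)) (hsub : cubeSkeleton k x r ⊆ ⋃ i, F i) :
    ∃ i, ∃ z : Fin n → ℝ, ∃ ε > 0, ∀ w : Fin n → ℝ, (∀ j, |w j - z j| ≤ ε) →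
      facePoint U σ x r w ∈ F i := by
  let O : Set (Fin n → ℝ) := ball x.ofLp r
  -- Baire is applied in all of `ℝⁿ`, where `facePoint` ignores the coordinates in `U`. The index
  -- `none` adds the complement of the open cube, so that closed sets cover the whole space.
  let T : Option ℕ → Set (Fin n → ℝ) := fun o => o.elim Oᶜ fun i => facePoint U σ x r ⁻¹' F i
  have hT : ∀ o, IsClosed (T o) := by
    rintro (_ | i)
    · exact isOpen_ball.isClosed_compl
    · exact (hF i).preimage (continuous_facePoint U σ x r)
  have hcov : ⋃ o, T o = univ := by
    refine eq_univ_of_forall fun w => ?_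
    by_cases hw : w ∈ O
    · have hmem := hsub (facePoint_mem_cubeSkeleton hk hU hσ (w := w) fun i =>
        (dist_le_pi_dist w x.ofLp i).trans (mem_ball.1 hw).le)
      obtain ⟨i, hi⟩ := mem_iUnion.1 hmem
      exact mem_iUnion.2 ⟨some i, hi⟩
    · exact mem_iUnion.2 ⟨none, hw⟩
  obtain ⟨z, hzO, hz⟩ := (dense_iUnion_interior_of_closed hT hcov).inter_open_nonempty O
    isOpen_ball ⟨x.ofLp, mem_ball_self hr⟩
  obtain ⟨o, ho⟩ := mem_iUnion.1 hz
  rcases o with _ | i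
  · exact absurd hzO (interior_subset ho)
  · obtain ⟨ε, hε, hball⟩ := Metric.mem_nhds_iff.1 (mem_interior_iff_mem_nhds.1 ho)
    refine ⟨i, z, ε / 2, by positivity, fun w hw => hball (mem_ball.2 ?_)⟩
    exact ((dist_pi_le_iff (by positivity)).2 hw).trans_lt (half_lt_self hε)

/-! ### The packing dimension bound. -/

/-- The counting inequality needs only `g` points over each vertex projection, not whole faces: a
piece of size `ε` provides `⌊ε / (δ / n)⌋₊ ^ k` grid points, whatever the size of the cube.
Separation keeps the rounded centres distinct. -/
theorem card_le_of_face_pieces {n k : ℕ} (hk : k < n) {A G : Set (EuclideanSpace ℝ (Fin n))}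
    {ε : ℝ} {δ : ℝ≥0} (hδ : 0 < δ) (hδε : δ / n ≤ ε) {N : ℕ}
    (hN : externalCoveringNumber δ G ≤ N)
    (hA : ∀ x ∈ A, ∃ r : ℝ, 0 < r ∧ ∀ U : Finset (Fin n), U.card = n - k → ∀ σ : Fin n → ℤ,
      (∀ i, σ i = 1 ∨ σ i = -1) → ∃ z : Fin n → ℝ, ∀ w : Fin n → ℝ, (∀ j, |w j - z j| ≤ ε) →
        facePoint U σ x r w ∈ G)
    {E : Finset (EuclideanSpace ℝ (Fin n))} (hE : (E : Set (EuclideanSpace ℝ (Fin n))) ⊆ A)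
    (hsep : (E : Set (EuclideanSpace ℝ (Fin n))).Pairwise fun x y => (δ : ℝ) < dist x y) :
    E.card ^ ((2 * n - 1) * (n - k)) * (⌊ε / (δ / n)⌋₊ ^ k) ^ (2 * n ^ 2) ≤
      (n + 1) ^ ((2 * n - 1) * (n - k)) * ((2 * n + 5) ^ n * N) ^ (2 * n ^ 2) := by
  classical
  have hn : 0 < n := by omega
  have hn' : (0 : ℝ) < n := by exact_mod_cast hn
  have : Nonempty (Fin n) := ⟨⟨0, hn⟩⟩
  have hδ' : (0 : ℝ) < δ := by exact_mod_cast hδ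
  have hη : (0 : ℝ) < δ / n := by positivity
  have hfin := gridNear_finite hn hδ hN
  have hcard := card_le_of_subset_gridNear hn hδ hN (B := hfin.toFinset) (by simp)
  have hinj : Set.InjOn (gridFloor (n := n) (δ / n)) E := by
    intro x hx y hy hxy
    by_contra hne
    have h1 := hsep hx hy hne
    have h2 : dist x y ≤ n * (δ / n) := by
      refine dist_le_of_forall_abs_sub_le hη.le fun i => ?_
      have h3 := mul_gridFloor_le hη x i
      have h4 := lt_mul_gridFloor_add hη x i
      have h5 := mul_gridFloor_le hη y i
      have h6 := lt_mul_gridFloor_add hη y i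
      rw [hxy] at h3 h4
      rw [abs_le]
      constructor <;> linarith
    rw [mul_div_cancel₀ _ hn'.ne'] at h2
    linarith
  have hx : ∀ a ∈ E.image (gridFloor (n := n) (δ / n)), ∃ x ∈ E, gridFloor (δ / n) x = a :=
    fun a ha => Finset.mem_image.1 ha
  choose! x hxE hxa using hx
  choose! r hr hface using hA
  have hcount := card_pow_mul_pow_le (ι := Fin n) (k := k) (by simpa using hk)
    (E.image (gridFloor (δ / n))) hfin.toFinset (fun a => ⌊r (x a) / (δ / n)⌋)
    (⌊ε / (δ / n)⌋₊ ^ k) ?_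
  · rw [Finset.card_image_of_injOn hinj, Fintype.card_fin] at hcount
    refine hcount.trans ?_
    gcongr
  · intro a ha σ hσ U hU
    have hxA := hE (Finset.mem_coe.2 (hxE a ha))
    obtain ⟨z, hz⟩ := hface _ hxA U (by simpa using hU) σ hσ
    refine pow_le_card_filter (by simpa using hk.le) hU _ _
      -- These are the first `⌊ε / (δ / n)⌋₊` grid values above `z i`; they all lie within `ε` of
      -- it.
      (fun i => Finset.Ioc ⌊z i / (δ / n)⌋ (⌊z i / (δ / n)⌋ + ⌊ε / (δ / n)⌋₊)) _
      (fun i _ => ?_) fun b hbU hb => ?_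
    · rw [Int.card_Ioc]
      omega
    rw [Set.Finite.mem_toFinset]
    -- `facePoint` does not read `w` on `U`; the value `z i` there only meets the distance
    -- condition.
    let w : Fin n → ℝ := fun i => if i ∈ U then z i else δ / n * b i
    refine ⟨facePoint U σ (x a) (r (x a)) w, hz w fun i => ?_, fun i => ?_⟩
    · by_cases hi : i ∈ U
      · simp only [w, hi, if_true, sub_self, abs_zero]
        exact hη.le.trans hδε
      · simp only [w, hi, if_false]
        obtain ⟨h1, h2⟩ := Finset.mem_Ioc.1 (hb i hi)
        rw [Int.floor_lt, div_lt_iff₀ hη] at h1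
        have h3 : (b i : ℝ) ≤ z i / (δ / n) + ε / (δ / n) := by
          have h4 : (b i : ℝ) ≤ ⌊z i / (δ / n)⌋ + (⌊ε / (δ / n)⌋₊ : ℝ) := by exact_mod_cast h2
          have h5 := Int.floor_le (z i / (δ / n))
          have h6 := Nat.floor_le (div_nonneg (hη.le.trans hδε) hη.le)
          linarith
        rw [← add_div, le_div_iff₀ hη] at h3
        rw [abs_le]
        constructor <;> linarith
    · by_cases hi : i ∈ U
      · simp only [facePoint, hi, if_true]
        rw [hbU i hi]
        have h1 := mul_gridFloor_le hη (x a) i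
        have h2 := lt_mul_gridFloor_add hη (x a) i
        rw [hxa a ha] at h1 h2
        have h3 := Int.floor_le (r (x a) / (δ / n))
        have h4 := Int.lt_floor_add_one (r (x a) / (δ / n))
        rw [le_div_iff₀ hη] at h3
        rw [div_lt_iff₀ hη] at h4
        rw [abs_le]
        rcases hσ i with hs | hs <;> rw [hs] <;> push_cast <;> constructor <;> linarith
      · simp only [facePoint, w, hi, if_false, sub_self, abs_zero]
        positivity

theorem exists_card_pow_le_rpow {n k : ℕ} (hk : k < n) {A G : Set (EuclideanSpace ℝ (Fin n))}
    {ε t : ℝ} (hε : 0 < ε) (hG : CoverBound t G)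
    (hA : ∀ x ∈ A, ∃ r : ℝ, 0 < r ∧ ∀ U : Finset (Fin n), U.card = n - k → ∀ σ : Fin n → ℤ,
      (∀ i, σ i = 1 ∨ σ i = -1) → ∃ z : Fin n → ℝ, ∀ w : Fin n → ℝ, (∀ j, |w j - z j| ≤ ε) →
        facePoint U σ x r w ∈ G) :
    ∃ C δ₀ : ℝ, 0 ≤ C ∧ 0 < δ₀ ∧ ∀ δ : ℝ, 0 < δ → δ ≤ δ₀ →
      ∀ E : Finset (EuclideanSpace ℝ (Fin n)), (E : Set (EuclideanSpace ℝ (Fin n))) ⊆ A →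
      (E : Set (EuclideanSpace ℝ (Fin n))).Pairwise (fun x y => δ < dist x y) →
      (E.card : ℝ) ^ ((2 * n - 1) * (n - k)) ≤ C * (δ ^ (k - t)) ^ (2 * n ^ 2) := by
  obtain ⟨C, hC, δ₀, hδ₀, hG⟩ := hG
  have hn : 0 < n := by omega
  have hn' : (0 : ℝ) < n := by exact_mod_cast hn
  have hδ₀' : (0 : ℝ) < δ₀ := by exact_mod_cast hδ₀
  refine ⟨(n + 1) ^ ((2 * n - 1) * (n - k)) *
    ((2 * n + 5) ^ n * C * (2 / (ε * n)) ^ k) ^ (2 * n ^ 2), min δ₀ (ε * n), by positivity,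
    lt_min hδ₀' (by positivity), fun δ hδ hδle E hE hsep => ?_⟩
  lift δ to ℝ≥0 using hδ.le
  obtain ⟨N, hN, hNC⟩ := hG δ (by exact_mod_cast hδ)
    (by exact_mod_cast hδle.trans (min_le_left _ _))
  have hδε : (δ : ℝ) / n ≤ ε := by
    rw [div_le_iff₀ hn']
    exact hδle.trans (min_le_right _ _)
  have hη : (0 : ℝ) < δ / n := by positivity
  have hmain := card_le_of_face_pieces hk (by exact_mod_cast hδ) hδε hN hA hE hsep
  have hT : 1 ≤ ε / (δ / n) := by rwa [le_div_iff₀ hη, one_mul]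
  set T := ε / ((δ : ℝ) / n) with hTdef
  -- For `T ≥ 1` the floor loses at most a factor 2.
  have hfloor : T / 2 ≤ ⌊T⌋₊ := by
    have h1 : (1 : ℝ) ≤ ⌊T⌋₊ := by exact_mod_cast Nat.le_floor (by simpa using hT)
    have h2 := Nat.lt_floor_add_one T
    linarith
  set Q := (2 * n - 1) * (n - k)
  set D := 2 * n ^ 2
  have hreal : (E.card : ℝ) ^ Q * ((T / 2) ^ k) ^ D ≤
      (n + 1) ^ Q * ((2 * n + 5) ^ n * (C * (δ : ℝ) ^ (-t))) ^ D := by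
    calc (E.card : ℝ) ^ Q * ((T / 2) ^ k) ^ D
        ≤ (E.card : ℝ) ^ Q * ((⌊T⌋₊ : ℝ) ^ k) ^ D := by gcongr
      _ ≤ (n + 1) ^ Q * ((2 * n + 5) ^ n * (N : ℝ)) ^ D := by exact_mod_cast hmain
      _ ≤ _ := by gcongr
  have hTk : (0 : ℝ) < ((T / 2) ^ k) ^ D := by positivity
  rw [← le_div_iff₀ hTk] at hreal
  refine hreal.trans (le_of_eq ?_)
  have e1 : ((T / 2) ^ k)⁻¹ = (2 / (ε * n)) ^ k * (δ : ℝ) ^ k := by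
    rw [← inv_pow, ← mul_pow, hTdef]
    congr 1
    field_simp
  rw [div_eq_mul_inv, ← inv_pow, e1, sub_eq_add_neg (k : ℝ), Real.rpow_add hδ, Real.rpow_natCast]
  ring

/-- Test the bound on a singleton: if `t < k`, the right-hand side tends to 0 with `δ`, while the
left-hand side is 1. -/
theorem natCast_le_of_card_pow_le {n k Q : ℕ} (hn : 0 < n) {A : Set (EuclideanSpace ℝ (Fin n))}
    (hA : A.Nonempty) {t C δ₀ : ℝ} (hδ₀ : 0 < δ₀)
    (h : ∀ δ : ℝ, 0 < δ → δ ≤ δ₀ →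
      ∀ E : Finset (EuclideanSpace ℝ (Fin n)), (E : Set (EuclideanSpace ℝ (Fin n))) ⊆ A →
      (E : Set (EuclideanSpace ℝ (Fin n))).Pairwise (fun x y => δ < dist x y) →
      (E.card : ℝ) ^ Q ≤ C * (δ ^ (k - t)) ^ (2 * n ^ 2)) : (k : ℝ) ≤ t := by
  by_contra! hlt
  obtain ⟨x, hx⟩ := hA
  have hlim : Tendsto (fun δ : ℝ => C * (δ ^ (k - t)) ^ (2 * n ^ 2)) (𝓝[>] 0) (𝓝 0) := by
    have h1 : Tendsto (fun δ : ℝ => δ ^ (k - t)) (𝓝[>] 0) (𝓝 0) := by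
      have := (Real.continuousAt_rpow_const 0 (k - t) (Or.inr (by linarith))).tendsto
      rw [Real.zero_rpow (by linarith)] at this
      exact this.mono_left nhdsWithin_le_nhds
    have h2 := (h1.pow (2 * n ^ 2)).const_mul C
    rwa [zero_pow (by positivity), mul_zero] at h2
  have hev : ∀ᶠ δ : ℝ in 𝓝[>] 0, 1 ≤ C * (δ ^ (k - t)) ^ (2 * n ^ 2) := by
    filter_upwards [Ioc_mem_nhdsGT hδ₀] with δ hδ
    have := h δ hδ.1 hδ.2 {x} (by simpa using hx) (by simp)
    simpa using this
  have := ge_of_tendsto hlim hev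
  linarith

/-- A cube has only finitely many choices of `U` and, up to signs, of vertex. So one `m` can exceed
all the indices and reciprocal sizes that Baire produces for them. -/
theorem exists_face_pieces_cover {n k : ℕ} (hk : k < n) {B S : Set (EuclideanSpace ℝ (Fin n))}
    (hB : ∀ x ∈ S, ∃ r : ℝ, 0 < r ∧ cubeSkeleton k x r ⊆ B)
    {F : ℕ → Set (EuclideanSpace ℝ (Fin n))} (hF : ∀ i, IsClosed (F i)) (hBF : B ⊆ ⋃ i, F i) :
    ∃ A : ℕ → Set (EuclideanSpace ℝ (Fin n)), S ⊆ ⋃ m, A m ∧ ∀ m, ∀ x ∈ A m, ∃ r : ℝ, 0 < r ∧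
      ∀ U : Finset (Fin n), U.card = n - k → ∀ σ : Fin n → ℤ, (∀ i, σ i = 1 ∨ σ i = -1) →
      ∃ z : Fin n → ℝ, ∀ w : Fin n → ℝ, (∀ j, |w j - z j| ≤ 1 / ((m : ℝ) + 1)) →
        facePoint U σ x r w ∈ ⋃ i ∈ Finset.range (m + 1), F i := by
  refine ⟨fun m => {x | ∃ r : ℝ, 0 < r ∧ ∀ U : Finset (Fin n), U.card = n - k →
    ∀ σ : Fin n → ℤ, (∀ i, σ i = 1 ∨ σ i = -1) → ∃ z : Fin n → ℝ, ∀ w : Fin n → ℝ,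
      (∀ j, |w j - z j| ≤ 1 / ((m : ℝ) + 1)) →
        facePoint U σ x r w ∈ ⋃ i ∈ Finset.range (m + 1), F i}, fun x hx => ?_, fun m x hx => hx⟩
  obtain ⟨r, hr, hrB⟩ := hB x hx
  let faces : Finset (Finset (Fin n) × (Fin n → ℤ)) :=
    (Finset.univ.filter fun U => U.card = n - k) ×ˢ Fintype.piFinset fun _ => {1, -1}
  have hfaces : ∀ U σ, (U, σ) ∈ faces ↔ U.card = n - k ∧ ∀ i, σ i = 1 ∨ σ i = -1 := by
    intro U σ
    simp [faces]
  have hev : ∀ p ∈ faces, ∀ᶠ m : ℕ in atTop, ∃ z : Fin n → ℝ, ∀ w : Fin n → ℝ,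
      (∀ j, |w j - z j| ≤ 1 / ((m : ℝ) + 1)) →
        facePoint p.1 p.2 x r w ∈ ⋃ i ∈ Finset.range (m + 1), F i := by
    rintro ⟨U, σ⟩ hp
    obtain ⟨hU, hσ⟩ := (hfaces U σ).1 hp
    obtain ⟨i, z, ε, hε, hz⟩ := exists_facePoint_mem_of_iUnion hk.le hU hσ hr hF (hrB.trans hBF)
    obtain ⟨m₀, hm₀⟩ := exists_nat_one_div_lt hε
    filter_upwards [eventually_ge_atTop (max i m₀)] with m hm
    refine ⟨z, fun w hw => Set.mem_biUnion (x := i) ?_ (hz w fun j => (hw j).trans ?_)⟩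
    · rw [Finset.mem_coe, Finset.mem_range]
      have := (le_max_left i m₀).trans hm
      omega
    · refine le_trans ?_ hm₀.le
      have : (m₀ : ℝ) ≤ m := by exact_mod_cast (le_max_right i m₀).trans hm
      gcongr
  obtain ⟨m, hm⟩ := ((Filter.eventually_all_finset faces).2 hev).exists
  exact mem_iUnion.2 ⟨m, r, hr, fun U hU σ hσ => hm (U, σ) ((hfaces U σ).2 ⟨hU, hσ⟩)⟩

theorem packingDim_le_of_packingDim_lt {n k : ℕ} (hk : k < n)
    {B S : Set (EuclideanSpace ℝ (Fin n))} (hS : S.Nonempty)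
    (hB : ∀ x ∈ S, ∃ r : ℝ, 0 < r ∧ cubeSkeleton k x r ⊆ B) {t : ℝ≥0}
    (ht : packingDim B < t) :
    (k : ℝ) ≤ t ∧ packingDim S ≤ ENNReal.ofReal
      ((t - k) * (2 * (n : ℝ) ^ 2) / (((n : ℝ) - k) * (2 * (n : ℝ) - 1))) := by
  have hn : 0 < n := by omega
  have hmeas : packingMeasure (t : ℝ) B < ∞ := by
    rw [lt_top_iff_ne_top]
    intro htop
    exact absurd ht (not_lt.2 (le_iSup₂_of_le (f := fun (s : ℝ≥0)
      (_ : packingMeasure (s : ℝ) B = ∞) => (s : ℝ≥0∞)) t htop le_rfl))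
  simp only [packingMeasure, iInf_lt_iff] at hmeas
  obtain ⟨F, hBF, hsum⟩ := hmeas
  have hF : ∀ i, CoverBound (t : ℝ) (closure (F i)) := fun i =>
    (coverBound_of_packingPremeasure_ne_top (ENNReal.ne_top_of_tsum_ne_top hsum.ne i)).closure
  obtain ⟨A, hSA, hA⟩ := exists_face_pieces_cover hk hB (fun i => isClosed_closure (s := F i))
    (hBF.trans (iUnion_mono fun i => subset_closure))
  have hcard := fun m => exists_card_pow_le_rpow hk (by positivity)
    (CoverBound.biUnion_finset (Finset.range (m + 1)) fun i _ => hF i) (hA m)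
  have hkt : (k : ℝ) ≤ t := by
    obtain ⟨x, hx⟩ := hS
    obtain ⟨m, hm⟩ := mem_iUnion.1 (hSA hx)
    obtain ⟨C, δ₀, -, hδ₀, h⟩ := hcard m
    exact natCast_le_of_card_pow_le hn ⟨x, hm⟩ hδ₀ h
  refine ⟨hkt, iSup₂_le fun s hs => ?_⟩
  have hn1 : (1 : ℝ) ≤ n := by exact_mod_cast hn
  have hkn : (0 : ℝ) < (n : ℝ) - k := by
    have : (k : ℝ) < n := by exact_mod_cast hk
    linarith
  -- `u` is the exponent for which the counting bound reads `|E| ≤ C' δ ^ (-u)`; it is nonnegative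
  -- because `k ≤ t`.
  set u := (t - k) * (2 * (n : ℝ) ^ 2) / (((n : ℝ) - k) * (2 * (n : ℝ) - 1)) with hu
  have hden : 0 < ((n : ℝ) - k) * (2 * (n : ℝ) - 1) := mul_pos hkn (by linarith)
  have hu0 : 0 ≤ u := div_nonneg (mul_nonneg (by linarith) (by positivity)) hden.le
  by_contra! hlt
  have hus : u < s := by
    have h1 : ENNReal.ofReal u < ENNReal.ofReal (s : ℝ) := by rwa [ENNReal.ofReal_coe_nnreal]
    exact (ENNReal.ofReal_lt_ofReal_iff_of_nonneg hu0).1 h1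
  have hzero : ∀ m, packingPremeasure (s : ℝ) (A m) = 0 := by
    intro m
    obtain ⟨C, δ₀, hC, hδ₀, h⟩ := hcard m
    set Q := (2 * n - 1) * (n - k) with hQ
    have hQ0 : Q ≠ 0 := (Nat.mul_pos (by omega) (by omega)).ne'
    have hQr : (Q : ℝ) = ((n : ℝ) - k) * (2 * (n : ℝ) - 1) := by
      rw [hQ, Nat.cast_mul, Nat.cast_sub hk.le, Nat.cast_sub (by omega)]
      push_cast
      ring
    refine packingPremeasure_eq_zero_of_separated_bound hus (NNReal.coe_nonneg s)
      (C := C ^ ((Q : ℝ)⁻¹)) (by positivity) hδ₀ fun δ hδ hδ' E hE hsep => ?_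
    refine (pow_le_pow_iff_left₀ (by positivity) (by positivity) hQ0).1
      ((h δ hδ hδ' E hE hsep).trans_eq ?_)
    rw [mul_pow, Real.rpow_inv_natCast_pow hC hQ0, ← Real.rpow_natCast, ← Real.rpow_natCast,
      ← Real.rpow_mul hδ.le, ← Real.rpow_mul hδ.le]
    congr 2
    rw [hQr, hu, neg_mul, div_mul_cancel₀ _ hden.ne']
    push_cast
    ring
  have hzero' : packingMeasure (s : ℝ) S = 0 := by
    refine le_antisymm ((iInf₂_le A hSA).trans_eq ?_) zero_le
    simp [hzero]
  rw [hzero'] at hs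
  exact ENNReal.zero_ne_top hs

/-- The preceding bound, solved for `t`, holds for every `t` above `packingDim B`; then `t`
decreases to it. -/
theorem packingDim_ge {n k : ℕ} (hk : k < n) {B S : Set (EuclideanSpace ℝ (Fin n))}
    (hS : S.Nonempty) (hB : ∀ x ∈ S, ∃ r : ℝ, 0 < r ∧ cubeSkeleton k x r ⊆ B) :
    (k : ℝ≥0∞) +
        ENNReal.ofReal (((n : ℝ) - k) * (2 * (n : ℝ) - 1) / (2 * (n : ℝ) ^ 2)) * packingDim S
      ≤ packingDim B := by
  refine le_of_forall_gt_imp_ge_of_dense fun c hc => ?_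
  obtain ⟨t, htB, htc⟩ := ENNReal.lt_iff_exists_nnreal_btwn.1 hc
  refine le_trans ?_ htc.le
  obtain ⟨hkt, hdim⟩ := packingDim_le_of_packingDim_lt hk hS hB htB
  have hn1 : (1 : ℝ) ≤ n := by exact_mod_cast (by omega : 1 ≤ n)
  have hkn : (0 : ℝ) < (n : ℝ) - k := by
    have : (k : ℝ) < n := by exact_mod_cast hk
    linarith
  have h2n : (0 : ℝ) < 2 * (n : ℝ) - 1 := by linarith
  have hcoef : 0 ≤ ((n : ℝ) - k) * (2 * (n : ℝ) - 1) / (2 * (n : ℝ) ^ 2) :=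
    div_nonneg (mul_pos hkn h2n).le (by positivity)
  calc (k : ℝ≥0∞) +
        ENNReal.ofReal (((n : ℝ) - k) * (2 * (n : ℝ) - 1) / (2 * (n : ℝ) ^ 2)) * packingDim S
      ≤ (k : ℝ≥0∞) +
        ENNReal.ofReal (((n : ℝ) - k) * (2 * (n : ℝ) - 1) / (2 * (n : ℝ) ^ 2)) *
          ENNReal.ofReal ((t - k) * (2 * (n : ℝ) ^ 2) / (((n : ℝ) - k) * (2 * (n : ℝ) - 1))) := by
        gcongr
    _ = ENNReal.ofReal k + ENNReal.ofReal (t - k) := by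
        rw [← ENNReal.ofReal_mul hcoef, ENNReal.ofReal_natCast]
        congr 2
        generalize 2 * (n : ℝ) - 1 = a at h2n
        field_simp
    _ = t := by
        rw [← ENNReal.ofReal_add (Nat.cast_nonneg k) (by linarith), add_sub_cancel,
          ENNReal.ofReal_coe_nnreal]

theorem mainTheorem1 (n k : ℕ) (hk : k < n) (B S : Set (EuclideanSpace ℝ (Fin n)))
    (hS : S.Nonempty) (hB : ∀ x ∈ S, ∃ r : ℝ, 0 < r ∧ cubeSkeleton k x r ⊆ B) :
    (k : ℝ≥0∞) +
        ENNReal.ofReal (((n : ℝ) - k) * (2 * (n : ℝ) - 1) / (2 * (n : ℝ) ^ 2)) * packingDim S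
      ≤ packingDim B ∧
    max ((k : ℝ) : EReal)
        (((1 - ((n : ℝ) - k) / (2 * (n : ℝ) ^ 2) : ℝ) : EReal) * upperBoxDim S)
      ≤ upperBoxDim B ∧
    max ((k : ℝ) : EReal)
        (((1 - ((n : ℝ) - k) / (2 * (n : ℝ) ^ 2) : ℝ) : EReal) * lowerBoxDim S)
      ≤ lowerBoxDim B :=
  ⟨packingDim_ge hk hS hB, max_le_boxDims hk hS hB⟩
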